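/- All graphs are finite and simple. A family of graphs $\mathcal F$ is hereditary if it is closed under isomorphism and under taking induced subgraphs; $\mathcal F^n$ denotes the set of graphs in $\mathcal F$ with vertex set $[n]=\{1,\dots,n\}$. A property $\mathcal Q$ holds for almost all graphs in $\mathcal F$ if $|\mathcal F^n\cap\mathcal Q|/|\mathcal F^n|\to 1$ as $n\to\infty$. For a sequence $\mathfrak T=(\mathcal T_1,\dots,\mathcal T_l)$ of families, a $\mathfrak T$-partition of a graph $G$ is a partition $(X_1,\dots,X_l)$ of $V(G)$, with empty parts allowed, such that $G[X_i]\in\mathcal T_i$ for every $i\in[l]$; $\mathcal P(\mathfrak T)=\mathcal P(\mathcal T_1,\dots,\mathcal T_l)$ is the family of all graphs admitting a $\mathfrak T$-partition. For $\varepsilon>0$ such a partition of an $n$-vertex graph is $\varepsilon$-balanced if $\bigl||X_i|-n/l\bigr|\le n^{1-\varepsilon}$ for every $i\in[l]$. Let $\mathcal H(s,t)$ be the family of all graphs whose vertex set can be partitioned into $s$ independent sets and $t$ cliques (possibly empty). The coloring number $\chi_c(\mathcal F)$ is the maximum integer $l$ such that $\mathcal H(s,l-s)\subseteq\mathcal F$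 for some $0\le s\le l$ (and $\infty$ if there is no maximum). For a graph $H$ let $\iota(H)$ be the family of all graphs isomorphic to an induced subgraph of $H$. With $m=\chi_c(\mathcal F)$, a graph $H$ is $\mathcal F$-reduced if $\mathcal P(\iota(H),\mathcal H(s,m-1-s))\subseteq\mathcal F$ for some integer $0\le s\le m-1$, and $\mathcal F$-dangerous otherwise. A substar is a (not necessarily induced) subgraph of a star, and an antisubstar is the complement of a substar. A hereditary family $\mathcal F$ is meager if $\chi_c(\mathcal F)\le 1$ and some substar and some antisubstar are $\mathcal F$-dangerous. A family $\mathcal F$ is extendable if $\chi_c(\mathcal F)\ge 1$ and there is $n_0\ge 0$ such that, for every $n\ge n_0$, every $G\in\mathcal F^n$ is a subgraph of some $G'\in\mathcal F^{n+1}$. Let $l\ge 1$ and let $\mathfrak T=(\mathcal T_1,\dots,\mathcal T_l)$, where each $\mathcal T_i$ is a meager extendable hereditary family. Then there exists $\varepsilon>0$ such that almost all graphs in $\mathcal P(\mathfrak T)$ admit a $\mathfrak T$-partition that is $\varepsilon$-balanced and is the unique $\mathfrak T$-partition as an unordered collection of parts: every $\mathfrak T$-partition of the graph is obtained from it by permuting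 the parts. -/

import Mathlib

/-- A family of finite graphs, given by its membership predicate. -/
structure GraphFamily where
  Mem : ∀ {V : Type} [Finite V], SimpleGraph V → Prop

namespace GraphFamily

/-- Inclusion of graph families. -/
def Subfamily (F₁ F₂ : GraphFamily) : Prop :=
  ∀ {V : Type} [Finite V] (G : SimpleGraph V), F₁.Mem G → F₂.Mem G

/-- A family is hereditary if it is closed under isomorphism and under taking induced subgraphs. -/
structure IsHereditary (F : GraphFamily) : Prop where
  iso : ∀ {V W : Type} [Finite V] [Finite W] {G : SimpleGraph V} {H : SimpleGraph W},
    (G ≃g H) → F.Mem G → F.Mem H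
  induce : ∀ {V : Type} [Finite V] {G : SimpleGraph V},
    F.Mem G → ∀ X : Set V, F.Mem (G.induce X)

/-- `X` is a partition of `V(G)` into parts indexed by `ι` (empty parts are allowed) such that
the part with index `i` induces a graph in the family `𝒯 i`. -/
structure IsPartition {ι : Type} (𝒯 : ι → GraphFamily) {V : Type} [Finite V]
    (G : SimpleGraph V) (X : ι → Set V) : Prop where
  disjoint : ∀ i j, i ≠ j → Disjoint (X i) (X j)
  cover : ⋃ i, X i = Set.univ
  mem : ∀ i, (𝒯 i).Mem (G.induce (X i))

/-- The family `𝒫(𝒯)` of all graphs that admit a `𝒯`-partition. -/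
def partitionable {ι : Type} (𝒯 : ι → GraphFamily) : GraphFamily where
  Mem G := ∃ X, IsPartition 𝒯 G X

/-- The family of all edgeless graphs. -/
def edgeless : GraphFamily where
  Mem G := G = ⊥

/-- The family of all complete graphs. -/
def complete : GraphFamily where
  Mem G := G = ⊤

/-- `ℋ(s, t)`: the graphs whose vertex set can be partitioned into `s` independent sets
and `t` cliques. -/
def stableClique (s t : ℕ) : GraphFamily :=
  partitionable (Sum.elim (fun _ : Fin s => edgeless) (fun _ : Fin t => complete))

/-- The coloring number `χ_c(F)`: the maximum `l` such that `ℋ(s, l - s) ⊆ F` for some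
`0 ≤ s ≤ l` (the value is `⊤` if there are arbitrarily large such `l`). -/
noncomputable def coloringNumber (F : GraphFamily) : ℕ∞ :=
  ⨆ l ∈ {l : ℕ | ∃ s ≤ l, Subfamily (stableClique s (l - s)) F}, (l : ℕ∞)

/-- A family is thin if its coloring number is at most one. -/
def IsThin (F : GraphFamily) : Prop :=
  F.coloringNumber ≤ 1

/-- `ι(H)`: the family of all graphs isomorphic to an induced subgraph of `H`. -/
def inducedSubgraphs {W : Type} (H : SimpleGraph W) : GraphFamily where
  Mem G := ∃ X : Set W, Nonempty (G ≃g H.induce X)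

/-- `H` is `F`-reduced if, with `l = χ_c(F)`, there is an integer `0 ≤ s ≤ l - 1` such that
`𝒫(ι(H), ℋ(s, l - 1 - s)) ⊆ F`. Here `t` is `l - 1 - s`. -/
def IsReduced (F : GraphFamily) {W : Type} (H : SimpleGraph W) : Prop :=
  ∃ s t : ℕ, ((s + t + 1 : ℕ) : ℕ∞) = F.coloringNumber ∧
    Subfamily (partitionable ![inducedSubgraphs H, stableClique s t]) F

/-- `H` is `F`-dangerous if it is not `F`-reduced. -/
def IsDangerous (F : GraphFamily) {W : Type} (H : SimpleGraph W) : Prop :=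
  ¬ F.IsReduced H

/-- A substar is a (not necessarily induced) subgraph of a star. -/
def IsSubstar {W : Type} (H : SimpleGraph W) : Prop :=
  ∃ m : ℕ, H.IsContained (completeBipartiteGraph (Fin 1) (Fin m))

/-- An antisubstar is the complement of a substar. -/
def IsAntisubstar {W : Type} (H : SimpleGraph W) : Prop :=
  IsSubstar Hᶜ

/-- A family `F` is apex-free if some substar and some antisubstar are `F`-dangerous. -/
def IsApexFree (F : GraphFamily) : Prop :=
  (∃ (n : ℕ) (H : SimpleGraph (Fin n)), IsSubstar H ∧ F.IsDangerous H) ∧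
  (∃ (n : ℕ) (H : SimpleGraph (Fin n)), IsAntisubstar H ∧ F.IsDangerous H)

/-- A family is meager if it is thin and apex-free. -/
def IsMeager (F : GraphFamily) : Prop :=
  F.IsThin ∧ F.IsApexFree

/-- The graphs in `F` on one more vertex that contain `G` as a subgraph. -/
def ext (F : GraphFamily) {n : ℕ} (G : SimpleGraph (Fin n)) : Set (SimpleGraph (Fin (n + 1))) :=
  {G' | F.Mem G' ∧ G.map Fin.castSuccEmb ≤ G'}

/-- A family is extendable if its coloring number is at least one and every sufficiently large
graph of the family on the vertex set `{0, …, n - 1}` has an extension in the family. -/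
def IsExtendable (F : GraphFamily) : Prop :=
  1 ≤ F.coloringNumber ∧
    ∃ n₀ : ℕ, ∀ n ≥ n₀, ∀ G : SimpleGraph (Fin n), F.Mem G → 1 ≤ (F.ext G).ncard

/-- A partition of an `n`-element set into parts indexed by `ι` is `ε`-balanced if the size of
every part differs from `n / |ι|` by at most `n ^ (1 - ε)`. -/
def IsBalanced (ε : ℝ) {ι V : Type} (X : ι → Set V) : Prop :=
  ∀ i, |((X i).ncard : ℝ) - (Nat.card V : ℝ) / (Nat.card ι : ℝ)| ≤ (Nat.card V : ℝ) ^ (1 - ε)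

/-- `Fⁿ`: the graphs in `F` on a fixed vertex set with `n` elements. -/
def onFin (F : GraphFamily) (n : ℕ) : Set (SimpleGraph (Fin n)) :=
  {G | F.Mem G}

/-- Almost all graphs of `F` belong to `P`: the proportion of the members of `Fⁿ` that
belong to `P` tends to one. -/
def AlmostAll (F P : GraphFamily) : Prop :=
  Filter.Tendsto
    (fun n : ℕ => ((F.onFin n ∩ P.onFin n).ncard : ℝ) / ((F.onFin n).ncard : ℝ))
    Filter.atTop (nhds 1)

/-- The graphs that admit a `𝒯`-partition that is `ε`-balanced and is the only `𝒯`-partition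
as a collection of parts: every `𝒯`-partition arises from it by relabelling the parts. -/
def uniquelyBalanced {ι : Type} (𝒯 : ι → GraphFamily) (ε : ℝ) : GraphFamily where
  Mem G := ∃ X, IsPartition 𝒯 G X ∧ IsBalanced ε X ∧
    ∀ Y, IsPartition 𝒯 G Y → ∃ σ : Equiv.Perm ι, Y = X ∘ σ

end GraphFamily

/-! The theorem rests on a rigidity of meager families. When χ_c = 1, a dangerous graph is simply
not a member, and a vertex with `k` neighbours and `k` non-neighbours in a large homogeneous set
produces every small substar (independent case) or antisubstar (clique case). So for some constant
`k` no vertex splits its own part of a `𝒯`-partition (`IsMeager.exists_not_splits`).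

This has two consequences. By Ramsey's theorem the neighbourhoods inside the parts have bounded VC
dimension, so only 2^(n^(2-δ)) graphs can occur inside the parts (`exists_card_le_two_rpow`). The
pairs between parts are unconstrained, so the number of graphs with a given partition is 2 to the
number of crossing pairs, up to that factor. An unbalanced partition loses at least n^(2-δ/2)/2
crossing pairs compared with an equipartition, up to a constant, which outweighs the choice of the
inside and of the partition (`exists_card_unbalanced_le`).

Conversely, fix a balanced partition `p` and the graph inside its parts. As the crossing pairs vary,
almost always every vertex splits every other part, even after boundedly many vertices are deleted,
and every large set outside a part has a vertex splitting any given linear-sized subset of that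
part. Any second partition without split parts must then be `p` with its parts permuted
(`exists_perm_of_splits`). The exceptional graphs, called ambiguous for `p`, are a fraction η(n) →
0, uniformly in `p` (`exists_card_ambiguous_le`).

It remains to pass from pairs (partition, graph) to graphs. A graph has at most l! partitions for
which it is unambiguous, so there are at most 2·l!·N balanced pairs once η ≤ 1/2, where N counts the
partitionable graphs. Hence at most 2·l!·η·N graphs are ambiguous for some balanced partition. -/

/-- A set of vertices is homogeneous if it is a clique or an independent set. -/
def SimpleGraph.IsHomogeneous {V : Type*} (G : SimpleGraph V) (A : Set V) : Prop :=
  G.IsClique A ∨ G.IsIndepSet A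

/-- The vertex `v` splits `Z` if some homogeneous subset of `Z` consists of `k` neighbours and
`k` non-neighbours of `v`. -/
def SimpleGraph.Splits {V : Type*} (G : SimpleGraph V) (k : ℕ) (v : V) (Z : Set V) : Prop :=
  ∃ B C : Finset V, B.card = k ∧ C.card = k ∧ Disjoint B C ∧ (B : Set V) ⊆ Z ∧ (C : Set V) ⊆ Z ∧
    G.IsHomogeneous (B ∪ C : Set V) ∧ (∀ b ∈ B, G.Adj v b) ∧ ∀ c ∈ C, c ≠ v ∧ ¬ G.Adj v c

/-! ### Substars and vertex splitting in meager families. -/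

namespace GraphFamily

open SimpleGraph

theorem exists_center_of_isSubstar {W : Type} {H : SimpleGraph W} (h : IsSubstar H) :
    IsEmpty W ∨ ∃ c, ∀ u w, H.Adj u w → u = c ∨ w = c := by
  obtain ⟨m, ⟨f⟩⟩ := h
  rcases isEmpty_or_nonempty W with hW | ⟨⟨w₀⟩⟩
  · exact Or.inl hW
  right
  by_cases hc : ∃ c, f.toHom c = Sum.inl 0
  · obtain ⟨c, hc⟩ := hc
    refine ⟨c, fun u w huw => ?_⟩
    have key : ∀ u, (f.toHom u).isLeft → u = c := by
      intro u hu
      apply f.injective'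
      rw [hc]
      obtain ⟨x, hx⟩ := Sum.isLeft_iff.1 hu
      rw [hx, Subsingleton.elim x 0]
    have := f.toHom.map_adj huw
    rw [completeBipartiteGraph_adj] at this
    rcases this with h | h
    · exact Or.inl (key _ h.1)
    · exact Or.inr (key _ h.2)
  -- If the centre of the star is not hit there are no edges, and any vertex serves as centre.
  · refine ⟨w₀, fun u w huw => (hc ?_).elim⟩
    have := f.toHom.map_adj huw
    rw [completeBipartiteGraph_adj] at this
    rcases this with h | h
    · obtain ⟨x, hx⟩ := Sum.isLeft_iff.1 h.1
      exact ⟨u, by rw [hx, Subsingleton.elim x 0]⟩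
    · obtain ⟨x, hx⟩ := Sum.isLeft_iff.1 h.2
      exact ⟨w, by rw [hx, Subsingleton.elim x 0]⟩

/-- A substar embeds into a vertex together with large independent sets of neighbours and
non-neighbours. -/
theorem exists_embedding_of_center {n : ℕ} {H : SimpleGraph (Fin n)} {V : Type*}
    {G : SimpleGraph V} {X : Set V}
    (h : IsEmpty (Fin n) ∨ ∃ c, ∀ u w, H.Adj u w → u = c ∨ w = c) {v : V} (hv : v ∈ X)
    {B C : Finset V} (hB : n ≤ B.card) (hC : n ≤ C.card) (hBC : Disjoint B C)
    (hBX : (B : Set V) ⊆ X) (hCX : (C : Set V) ⊆ X) (hind : G.IsIndepSet (B ∪ C : Set V))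
    (hadj : ∀ b ∈ B, G.Adj v b) (hnadj : ∀ c ∈ C, c ≠ v ∧ ¬ G.Adj v c) :
    Nonempty (H ↪g G.induce X) := by
  classical
  rcases h with h | ⟨c, hc⟩
  · exact ⟨⟨⟨fun u => (h.false u).elim, fun u => (h.false u).elim⟩, fun {u} => (h.false u).elim⟩⟩
  obtain ⟨f⟩ : Nonempty (Fin n ↪ B) := Function.Embedding.nonempty_of_card_le (by simpa using hB)
  obtain ⟨g⟩ : Nonempty (Fin n ↪ C) := Function.Embedding.nonempty_of_card_le (by simpa using hC)
  -- The centre goes to `v`, its neighbours into `B` and all other vertices into `C`. Every edge of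
  -- `H` meets the centre, so independence of `B ∪ C` makes the copy induced.
  let e : Fin n → V := fun u => if u = c then v else if H.Adj c u then f u else g u
  have hfg : ∀ u w, (f u : V) ≠ g w := fun u w h =>
    Finset.disjoint_left.1 hBC (f u).2 (h ▸ (g w).2)
  have hvf : ∀ u, v ≠ f u := fun u => (hadj _ (f u).2).ne
  have hvg : ∀ u, v ≠ g u := fun u => (hnadj _ (g u).2).1.symm
  have he : Function.Injective e := by
    intro u w h
    simp only [e] at h
    have hff : ∀ u w, (f u : V) = f w → u = w := fun u w h => f.injective (Subtype.ext h)
    have hgg : ∀ u w, (g u : V) = g w → u = w := fun u w h => g.injective (Subtype.ext h)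
    split_ifs at h with h1 h2 h3 h4 h5 h6 h7 h8
    · rw [h1, h2]
    · exact (hvf _ h).elim
    · exact (hvg _ h).elim
    · exact (hvf _ h.symm).elim
    · exact hff _ _ h
    · exact (hfg _ _ h).elim
    · exact (hvg _ h.symm).elim
    · exact (hfg _ _ h.symm).elim
    · exact hgg _ _ h
  have heX : ∀ u, e u ∈ X := by
    intro u
    simp only [e]
    split_ifs
    · exact hv
    · exact hBX (f u).2
    · exact hCX (g u).2
  have hec : ∀ u, u ≠ c → e u ∈ (B ∪ C : Set V) := by
    intro u hu
    simp only [e, if_neg hu]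
    split_ifs
    · exact Or.inl (f u).2
    · exact Or.inr (g u).2
  have hcu : ∀ u, u ≠ c → (G.Adj v (e u) ↔ H.Adj c u) := by
    intro u hu
    simp only [e, if_neg hu]
    split_ifs with h
    · simp [h, hadj _ (f u).2]
    · simp [h, (hnadj _ (g u).2).2]
  have hcc : e c = v := by simp [e]
  refine ⟨⟨⟨fun u => ⟨e u, heX u⟩, fun u w h => he (Subtype.ext_iff.1 h)⟩, ?_⟩⟩
  intro u w
  change G.Adj (e u) (e w) ↔ H.Adj u w
  by_cases hu : u = c
  · by_cases hw : w = c
    · subst hu; subst hw; simp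
    · rw [hu, hcc, hcu w hw]
  · by_cases hw : w = c
    · rw [hw, hcc, G.adj_comm, hcu u hu, H.adj_comm]
    · refine iff_of_false (fun h => hind (hec u hu) (hec w hw) h.ne h) fun h => ?_
      rcases hc u w h with h | h <;> contradiction

theorem IsHereditary.mem_of_embedding {F : GraphFamily} (hF : F.IsHereditary) {V W : Type}
    [Finite V] [Finite W] {H : SimpleGraph W} {G : SimpleGraph V} (e : H ↪g G) (h : F.Mem G) :
    F.Mem H :=
  hF.iso e.isoInduceRange.symm (hF.induce h _)

/-- All vertices can be put into one class of ℋ(s, m - s), the others being empty. This supplies a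
base graph for each part, hence the lower bound on the number of partitionable graphs. -/
theorem edgeless_or_complete_subfamily {F : GraphFamily} (h : 1 ≤ F.coloringNumber) :
    Subfamily edgeless F ∨ Subfamily complete F := by
  obtain ⟨m, hm, s, hs, hsub⟩ : ∃ m : ℕ, 1 ≤ m ∧ ∃ s ≤ m, Subfamily (stableClique s (m - s)) F := by
    by_contra hcon
    have : F.coloringNumber ≤ 0 := by
      refine iSup₂_le fun m hm => ?_
      by_contra h0
      exact hcon ⟨m, by
        rcases Nat.eq_zero_or_pos m with h | h
        · simp [h] at h0
        · exact h, hm⟩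
    exact absurd (h.trans this) (by simp)
  rcases Nat.eq_zero_or_pos s with h0 | h0
  · right
    intro V _ G hG
    refine hsub G ⟨fun i => {_v | i = Sum.inr ⟨0, by omega⟩}, ?_, ?_, ?_⟩
    · intro i j hij
      rw [Set.disjoint_left]
      intro v hi hj
      exact hij (hi.trans hj.symm)
    · ext v
      simp
    · have hG : G = ⊤ := hG
      subst hG
      rintro (i | i)
      · exact absurd i.2 (by omega)
      · change SimpleGraph.induce _ _ = ⊤
        ext u w
        simp [Subtype.ext_iff]
  · left
    intro V _ G hG
    refine hsub G ⟨fun i => {_v | i = Sum.inl ⟨0, by omega⟩}, ?_, ?_, ?_⟩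
    · intro i j hij
      rw [Set.disjoint_left]
      intro v hi hj
      exact hij (hi.trans hj.symm)
    · ext v
      simp
    · have hG : G = ⊥ := hG
      subst hG
      rintro (i | i)
      · change SimpleGraph.induce _ _ = ⊥
        ext u w
        simp
      · change SimpleGraph.induce _ _ = ⊤
        ext u w
        exact absurd u.2 (by simp)

/-- When χ_c = 1 the only companion is ℋ(0, 0), which contains only the graph without vertices. Used
in contrapositive form: dangerous graphs are forbidden. -/
theorem IsHereditary.isReduced_of_mem {F : GraphFamily} (hF : F.IsHereditary)
    (h : F.coloringNumber = 1) {W : Type} [Finite W] {H : SimpleGraph W} (hH : F.Mem H) :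
    F.IsReduced H := by
  refine ⟨0, 0, by simp [h], ?_⟩
  intro V _ G ⟨X, hX⟩
  obtain ⟨Y, hY⟩ : (stableClique 0 0).Mem (G.induce (X 1)) := hX.mem 1
  have h1 : X 1 = ∅ := by
    rw [Set.eq_empty_iff_forall_notMem]
    intro v hv
    have : (⟨v, hv⟩ : X 1) ∈ ⋃ i, Y i := by rw [hY.cover]; trivial
    obtain ⟨i, -⟩ := Set.mem_iUnion.1 this
    exact isEmptyElim i
  have h0 : ∀ v, v ∈ X 0 := by
    intro v
    have : v ∈ ⋃ i, X i := by rw [hX.cover]; trivial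
    obtain ⟨i, hi⟩ := Set.mem_iUnion.1 this
    fin_cases i
    · exact hi
    · simp [h1] at hi
  obtain ⟨Z, ⟨f⟩⟩ : (inducedSubgraphs H).Mem (G.induce (X 0)) := hX.mem 0
  have e : G ↪g G.induce (X 0) := ⟨⟨fun v => ⟨v, h0 v⟩, fun u w h => by simpa using h⟩, fun {_ _} => Iff.rfl⟩
  exact hF.mem_of_embedding (((Embedding.induce Z).comp f.toEmbedding).comp e) hH

/-- In a meager hereditary family no vertex splits a large homogeneous set. -/
theorem IsMeager.exists_not_splits {F : GraphFamily} (hF : F.IsHereditary) (hm : F.IsMeager)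
    (h1 : 1 ≤ F.coloringNumber) :
    ∃ k₀, ∀ k ≥ k₀, ∀ {V : Type} [Finite V] (G : SimpleGraph V) (X : Set V),
      F.Mem (G.induce X) → ∀ v ∈ X, ¬ G.Splits k v X := by
  obtain ⟨hthin, ⟨n₁, H₁, hs₁, hd₁⟩, n₂, H₂, hs₂, hd₂⟩ := hm
  have hc : F.coloringNumber = 1 := le_antisymm hthin h1
  refine ⟨max n₁ n₂, fun k hk V _ G X hG v hv => ?_⟩
  have hk₁ : n₁ ≤ k := (le_max_left _ _).trans hk
  have hk₂ : n₂ ≤ k := (le_max_right _ _).trans hk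
  rintro ⟨B, C, hB, hC, hBC, hBX, hCX, hhom | hhom, hadj, hnadj⟩
  -- Clique case: in the complement, `C` becomes the set of neighbours of `v` and `B ∪ C` becomes
  -- independent, so the substar `H₂ᶜ` embeds.
  · obtain ⟨e⟩ := exists_embedding_of_center (G := Gᶜ) (exists_center_of_isSubstar hs₂) hv
      (hk₂.trans_eq hC.symm) (hk₂.trans_eq hB.symm) hBC.symm hCX hBX
      (by rwa [isIndepSet_compl, Set.union_comm])
      (fun c hc => (compl_adj _ _ _).2 ⟨(hnadj c hc).1.symm, (hnadj c hc).2⟩)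
      (fun b hb => ⟨(hadj b hb).ne.symm, by simp [hadj b hb]⟩)
    have e' : H₂ᶜ ↪g (G.induce X)ᶜ :=
      ⟨e.toEmbedding, by
        intro u w
        have hne : u ≠ w ↔ (e u : V) ≠ e w := (Subtype.coe_injective.comp e.injective).ne_iff.symm
        have hadj : Gᶜ.Adj (e u : V) (e w) ↔ H₂ᶜ.Adj u w := e.map_adj_iff
        rw [← hadj]
        change ((e u : X) ≠ e w ∧ ¬ G.Adj (e u : V) (e w)) ↔ _
        rw [compl_adj, ← hne, e.injective.ne_iff]⟩
    exact hd₂ (hF.isReduced_of_mem hc (hF.mem_of_embedding (Embedding.complEquiv.symm e') hG))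
  · obtain ⟨e⟩ := exists_embedding_of_center (exists_center_of_isSubstar hs₁) hv
      (hk₁.trans_eq hB.symm) (hk₁.trans_eq hC.symm) hBC hBX hCX hhom hadj hnadj
    exact hd₁ (hF.isReduced_of_mem hc (hF.mem_of_embedding e hG))

end GraphFamily

/-! ### Ramsey's theorem and graphs of bounded VC dimension. -/

namespace SimpleGraph

open Finset

/-- Ramsey's theorem for graphs. -/
theorem exists_ramsey (a b : ℕ) : ∃ R : ℕ, ∀ {V : Type} (G : SimpleGraph V) (A : Finset V),
    R ≤ #A → (∃ B ⊆ A, #B = a ∧ G.IsClique (B : Set V)) ∨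
      ∃ B ⊆ A, #B = b ∧ G.IsIndepSet (B : Set V) := by
  classical
  induction a generalizing b with
  | zero => exact ⟨0, fun G A _ => Or.inl ⟨∅, by simp⟩⟩
  | succ a iha =>
    induction b with
    | zero => exact ⟨0, fun G A _ => Or.inr ⟨∅, by simp⟩⟩
    | succ b ihb =>
      obtain ⟨R₁, h₁⟩ := iha (b + 1)
      obtain ⟨R₂, h₂⟩ := ihb
      refine ⟨R₁ + R₂ + 1, fun {V} G A hA => ?_⟩
      obtain ⟨v, hv⟩ : A.Nonempty := card_pos.1 (by omega)
      have hsum := card_filter_add_card_filter_not (s := A.erase v) (fun w => G.Adj v w)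
      rw [card_erase_of_mem hv] at hsum
      have hsub : ∀ (q : V → Prop) [DecidablePred q], {w ∈ A.erase v | q w} ⊆ A :=
        fun q _ => (filter_subset _ _).trans (erase_subset _ _)
      rcases le_or_gt R₁ #{w ∈ A.erase v | G.Adj v w} with h | h
      · rcases h₁ G _ h with ⟨B, hB, hc, hB'⟩ | ⟨B, hB, hc, hB'⟩
        · have hvB : v ∉ B := fun hv' => by simpa using hB hv'
          refine Or.inl ⟨insert v B, insert_subset hv (hB.trans (hsub _)),
            by rw [card_insert_of_notMem hvB, hc], ?_⟩
          rw [coe_insert]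
          exact hB'.insert fun w hw _ => (mem_filter.1 (hB hw)).2
        · exact Or.inr ⟨B, hB.trans (hsub _), hc, hB'⟩
      · have h : R₂ ≤ #{w ∈ A.erase v | ¬ G.Adj v w} := by omega
        rcases h₂ G _ h with ⟨B, hB, hc, hB'⟩ | ⟨B, hB, hc, hB'⟩
        · exact Or.inl ⟨B, hB.trans (hsub _), hc, hB'⟩
        · have hvB : v ∉ B := fun hv' => by simpa using hB hv'
          refine Or.inr ⟨insert v B, insert_subset hv (hB.trans (hsub _)),
            by rw [card_insert_of_notMem hvB, hc], ?_⟩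
          rw [← isClique_compl] at hB' ⊢
          rw [coe_insert]
          exact hB'.insert fun w hw hne =>
            (compl_adj _ _ _).2 ⟨hne, (mem_filter.1 (hB hw)).2⟩

theorem exists_homogeneous (k : ℕ) : ∃ R ≥ k, ∀ {V : Type} (G : SimpleGraph V) (A : Finset V),
    R ≤ #A → ∃ B ⊆ A, #B = k ∧ G.IsHomogeneous (B : Set V) := by
  obtain ⟨R, hR⟩ := exists_ramsey k k
  refine ⟨max k R, le_max_left _ _, fun {V} G A hA => ?_⟩
  rcases hR G A ((le_max_right _ _).trans hA) with ⟨B, hB, hc, h⟩ | ⟨B, hB, hc, h⟩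
  · exact ⟨B, hB, hc, Or.inl h⟩
  · exact ⟨B, hB, hc, Or.inr h⟩

/-- The part of a graph that lies inside the fibres of `p`. -/
def inside {V ι : Type*} (p : V → ι) (G : SimpleGraph V) : SimpleGraph V where
  Adj u w := G.Adj u w ∧ p u = p w
  symm := ⟨fun _ _ h => ⟨h.1.symm, h.2.symm⟩⟩
  loopless := ⟨fun _ h => G.loopless.irrefl _ h.1⟩

open scoped Classical in
/-- The collection of the neighbourhoods of a graph. -/
noncomputable def neighborhoods {V : Type*} [Fintype V] (G : SimpleGraph V) : Finset (Finset V) :=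
  univ.image fun v => ({w | G.Adj v w} : Finset V)

theorem mem_neighborhoods {V : Type*} [Fintype V] {G : SimpleGraph V} {u : Finset V} :
    u ∈ G.neighborhoods ↔ ∃ v, ∀ w, w ∈ u ↔ G.Adj v w := by
  simp only [neighborhoods, mem_image, mem_univ, true_and]
  constructor
  · rintro ⟨v, rfl⟩
    exact ⟨v, fun w => by simp⟩
  · rintro ⟨v, h⟩
    exact ⟨v, by ext w; simp [h]⟩

/-- If no vertex splits its own part, then the graph inside the parts has bounded
Vapnik-Chervonenkis dimension. -/
theorem card_lt_of_shatters_inside {k R : ℕ} (hk : 2 ≤ k)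
    (hR : ∀ {V : Type} (G : SimpleGraph V) (A : Finset V),
      R ≤ #A → ∃ B ⊆ A, #B = 2 * k ∧ G.IsHomogeneous (B : Set V))
    {V ι : Type} [Fintype V] [DecidableEq V] (p : V → ι) (G : SimpleGraph V)
    (hG : ∀ v, ¬ G.Splits k v {w | p w = p v}) {A : Finset V}
    (hA : (inside p G).neighborhoods.Shatters A) : #A < R := by
  by_contra! hcard
  obtain ⟨B, hBA, hB, hhom⟩ := hR G A hcard
  have hsh : ∀ C ⊆ B, ∃ v, ∀ w ∈ B, (G.Adj v w ∧ p v = p w) ↔ w ∈ C := by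
    intro C hC
    obtain ⟨u, hu, hCu⟩ := hA.mono_right hBA hC
    obtain ⟨v, hv⟩ := mem_neighborhoods.1 hu
    refine ⟨v, fun w hw => ?_⟩
    rw [← hCu, mem_inter, hv, and_iff_right hw]
    rfl
  -- Tracing all of `B` shows that `B` lies in a single part. Tracing one half `C` then gives a
  -- vertex of that part that splits it.
  obtain ⟨v₀, hv₀⟩ := hsh B subset_rfl
  have hp : ∀ w ∈ B, p w = p v₀ := fun w hw => (((hv₀ w hw).2 hw).2).symm
  obtain ⟨C, hCB, hC⟩ := exists_subset_card_eq (s := B) (n := k) (by omega)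
  obtain ⟨v, hv⟩ := hsh C hCB
  obtain ⟨c, hc⟩ : C.Nonempty := card_pos.1 (by omega)
  have hpv : p v = p v₀ := ((hv c (hCB hc)).2 hc).2.trans (hp c (hCB hc))
  have hpB : ∀ w ∈ B, p w = p v := fun w hw => (hp w hw).trans hpv.symm
  have hadj : ∀ w ∈ B, G.Adj v w ↔ w ∈ C := fun w hw => by
    rw [← hv w hw, and_iff_left (hpB w hw).symm]
  have hBC : #(B \ C) = k := by rw [card_sdiff_of_subset hCB]; omega
  -- A vertex of a clique `B` would be adjacent to the rest of `B`, forcing `B \ C` into one point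
  -- although it has `k ≥ 2`; a vertex of an independent `B` has no neighbour in `C`.
  have hvB : v ∉ B := by
    intro hvB
    rcases hhom with h | h
    · have hsub : B \ C ⊆ {v} := by
        intro w hw
        rw [mem_sdiff] at hw
        by_contra hne
        exact hw.2 ((hadj w hw.1).1 (h hvB hw.1 fun h => hne (by simp [h])))
      have := card_le_card hsub
      rw [card_singleton] at this
      omega
    · exact h hvB (hCB hc) ((hadj c (hCB hc)).2 hc).ne ((hadj c (hCB hc)).2 hc)
  refine hG v ⟨C, B \ C, hC, hBC, disjoint_sdiff, fun w hw => hpB w (hCB hw),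
    fun w hw => hpB w (mem_sdiff.1 hw).1, ?_, fun w hw => (hadj w (hCB hw)).2 hw, fun w hw => ?_⟩
  · rwa [← coe_union, union_sdiff_of_subset hCB]
  · rw [mem_sdiff] at hw
    exact ⟨fun h => hvB (h ▸ hw.1), fun h => hw.2 ((hadj w hw.1).1 h)⟩

-- Such a function factors through `Fin t`: list its values, then label each point.
open scoped Classical in
theorem card_functions_card_image_le {α β : Type*} [Fintype α] [Fintype β] [Nonempty β] (t : ℕ) :
    #{f : α → β | #(univ.image f) ≤ t} ≤ Fintype.card β ^ t * t ^ Fintype.card α := by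
  have hsub : ({f : α → β | #(univ.image f) ≤ t} : Finset (α → β)) ⊆
      (univ : Finset ((Fin t → β) × (α → Fin t))).image fun x => x.1 ∘ x.2 := by
    intro f hf
    simp only [mem_filter, mem_univ, true_and] at hf
    obtain ⟨e⟩ : Nonempty (↥(univ.image f) ↪ Fin t) :=
      Function.Embedding.nonempty_of_card_le (by rwa [Fintype.card_coe, Fintype.card_fin])
    refine mem_image.2 ⟨(Function.extend e Subtype.val fun _ => Classical.arbitrary β,
      fun a => e ⟨f a, mem_image_of_mem _ (mem_univ a)⟩), mem_univ _, ?_⟩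
    funext a
    simp [e.injective.extend_apply]
  refine (card_le_card hsub).trans (card_image_le.trans ?_)
  simp

open scoped Classical in
/-- The neighbourhoods of the vertices in the `j`-th block of `b` consecutive vertices. -/
noncomputable def blockTrace {n : ℕ} (b : ℕ) (H : SimpleGraph (Fin n)) (j : ℕ) (v : Fin n) :
    Finset (Fin b) :=
  {x | ∃ h : j * b + x < n, H.Adj v ⟨j * b + x, h⟩}

theorem mem_blockTrace {n b : ℕ} {H : SimpleGraph (Fin n)} {j : ℕ} {v : Fin n} {x : Fin b} :
    x ∈ H.blockTrace b j v ↔ ∃ h : j * b + x < n, H.Adj v ⟨j * b + x, h⟩ := by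
  simp [blockTrace]

/-- Sauer–Shelah on the `b` points of a block: a set shattered by the traces shifts to a set of
vertices shattered by the neighbourhoods. -/
theorem card_image_blockTrace_le {n b d : ℕ} (hb : 1 ≤ b) {H : SimpleGraph (Fin n)}
    (hH : ∀ A, H.neighborhoods.Shatters A → #A < d) (j : ℕ) :
    #(univ.image (H.blockTrace b j)) ≤ (b + 1) ^ d := by
  set 𝒯 := univ.image (H.blockTrace b j) with h𝒯
  have hvc : ∀ A, 𝒯.Shatters A → #A < d := by
    intro A hA
    -- The last block may overrun `n`, but a shattered point belongs to some trace and so is a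
    -- vertex.
    have hlt : ∀ x ∈ A, j * b + x < n := by
      intro x hx
      obtain ⟨u, hu, hAu⟩ := hA subset_rfl
      obtain ⟨v, -, rfl⟩ := mem_image.1 hu
      have := inter_eq_left.1 hAu hx
      exact (mem_blockTrace.1 this).1
    let e : A → Fin n := fun x => ⟨j * b + x.1, hlt x.1 x.2⟩
    have he : Function.Injective e := by
      intro x y h
      simp only [e, Fin.mk.injEq, Nat.add_left_cancel_iff] at h
      exact Subtype.ext (Fin.ext h)
    have hcard : #(univ.image e) = #A := by
      rw [card_image_of_injective _ he, card_univ, Fintype.card_coe]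
    rw [← hcard]
    refine hH _ fun C hC => ?_
    classical
    obtain ⟨u, hu, hAu⟩ := hA (t := {x ∈ A | ∃ h : x ∈ A, e ⟨x, h⟩ ∈ C}) (filter_subset _ _)
    obtain ⟨v, -, rfl⟩ := mem_image.1 hu
    refine ⟨({w | H.Adj v w} : Finset (Fin n)), mem_neighborhoods.2 ⟨v, fun w => by simp⟩, ?_⟩
    ext w
    have key : ∀ x : A, H.Adj v (e x) ↔ e x ∈ C := by
      intro x
      have := congrArg (fun s => x.1 ∈ s) hAu
      simp only [mem_inter, mem_blockTrace, mem_filter, eq_iff_iff] at this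
      constructor
      · intro h
        exact (this.1 ⟨x.2, hlt _ x.2, h⟩).2.2
      · intro h
        exact (this.2 ⟨x.2, x.2, h⟩).2.2
    constructor
    · intro hw
      simp only [mem_inter, mem_image, mem_univ, true_and] at hw
      obtain ⟨⟨x, rfl⟩, h⟩ := hw
      exact (key x).1 (mem_filter.1 h).2
    · intro hw
      obtain ⟨x, -, rfl⟩ := mem_image.1 (hC hw)
      simp only [mem_inter, mem_image, mem_univ, true_and]
      exact ⟨⟨x, rfl⟩, mem_filter.2 ⟨mem_univ _, (key x).2 hw⟩⟩
  have hsub : 𝒯.shatterer ⊆ (range d).biUnion fun i => powersetCard i univ := by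
    intro A hA
    rw [mem_shatterer] at hA
    simp [hvc A hA]
  calc #𝒯 ≤ #𝒯.shatterer := card_le_card_shatterer _
    _ ≤ ∑ i ∈ range d, #(powersetCard i (univ : Finset (Fin b))) :=
        (card_le_card hsub).trans card_biUnion_le
    _ ≤ ∑ i ∈ range d, (b + 1) ^ i := by
        gcongr with i hi
        rw [card_powersetCard, card_univ, Fintype.card_fin]
        exact (Nat.choose_le_pow b i).trans (Nat.pow_le_pow_left (by omega) _)
    _ ≤ (b + 1) ^ d := (Nat.geomSum_lt (by omega) (by simp)).le

/-- The graph is determined by its `n / b + 1` blocks of columns, and on each block the map from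
vertices to traces takes few values. -/
theorem card_le_of_shatters {n b d : ℕ} (hb : 1 ≤ b) (𝓗 : Finset (SimpleGraph (Fin n)))
    (h𝓗 : ∀ H ∈ 𝓗, ∀ A, H.neighborhoods.Shatters A → #A < d) :
    #𝓗 ≤ ((2 ^ b) ^ (b + 1) ^ d * ((b + 1) ^ d) ^ n) ^ (n / b + 1) := by
  classical
  set 𝒞 : Finset (Fin n → Finset (Fin b)) := {f | #(univ.image f) ≤ (b + 1) ^ d}
  have hinj : Set.InjOn (fun (H : SimpleGraph (Fin n)) (j : Fin (n / b + 1)) => H.blockTrace b j)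
      (𝓗 : Set (SimpleGraph (Fin n))) := by
    intro H _ H' _ h
    ext v w
    have hw : (w : ℕ) / b * b + w % b = w := Nat.div_add_mod' _ _
    have := congrFun (congrFun h ⟨w / b, Nat.lt_succ_of_le (Nat.div_le_div_right w.2.le)⟩) v
    have := congrArg (fun s => (⟨w % b, Nat.mod_lt _ hb⟩ : Fin b) ∈ s) this
    simp only [mem_blockTrace, hw, eq_iff_iff, Fin.is_lt, Fin.eta, exists_true_left] at this
    exact this
  calc #𝓗 ≤ #(Fintype.piFinset fun _ : Fin (n / b + 1) => 𝒞) := by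
        refine card_le_card_of_injOn _ (fun H hH => ?_) hinj
        rw [mem_coe, Fintype.mem_piFinset]
        intro j
        simp only [𝒞, mem_filter, mem_univ, true_and]
        convert card_image_blockTrace_le hb (h𝓗 H hH) j
    _ = #𝒞 ^ (n / b + 1) := by simp
    _ ≤ _ := by
        have h := card_functions_card_image_le (α := Fin n) (β := Finset (Fin b)) ((b + 1) ^ d)
        rw [Fintype.card_finset, Fintype.card_fin, Fintype.card_fin] at h
        refine Nat.pow_le_pow_left (le_trans (le_of_eq ?_) h) _
        simp only [𝒞]
        congr!

end SimpleGraph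

/-! ### Asymptotic form of the count. -/

namespace SimpleGraph

open Finset Filter

theorem eventually_three_mul_logb_le {a : ℝ} (ha : 0 < a) :
    ∀ᶠ n : ℕ in atTop, 3 * Real.logb 2 (2 * n) ≤ (n : ℝ) ^ (a / 2) := by
  have hc : 0 < Real.log 2 / (3 * 2 ^ (a / 2)) := by positivity
  have h := (isLittleO_log_rpow_atTop (half_pos ha)).bound hc
  have ht : Tendsto (fun n : ℕ => 2 * (n : ℝ)) atTop atTop :=
    tendsto_natCast_atTop_atTop.const_mul_atTop (by norm_num)
  filter_upwards [ht.eventually h] with n hn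
  have h2 : (0 : ℝ) < Real.log 2 := Real.log_pos (by norm_num)
  rw [Real.norm_of_nonneg (by positivity : (0 : ℝ) ≤ (2 * (n : ℝ)) ^ (a / 2)),
    Real.mul_rpow (by norm_num) (by positivity)] at hn
  have h3 := (le_abs_self _).trans hn
  rw [Real.logb, ← mul_div_assoc, div_le_iff₀ h2]
  calc 3 * Real.log (2 * n)
      ≤ 3 * (Real.log 2 / (3 * 2 ^ (a / 2)) * (2 ^ (a / 2) * (n : ℝ) ^ (a / 2))) := by gcongr
    _ = (n : ℝ) ^ (a / 2) * Real.log 2 := by field_simp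

/-- There are at most `2 ^ n ^ (2 - δ)` graphs of bounded Vapnik-Chervonenkis dimension. -/
theorem exists_card_le_two_rpow (d : ℕ) : ∃ δ : ℝ, 0 < δ ∧ δ < 1 ∧ ∀ᶠ n : ℕ in atTop,
    ∀ 𝓗 : Finset (SimpleGraph (Fin n)), (∀ H ∈ 𝓗, ∀ A, H.neighborhoods.Shatters A → #A < d) →
      (#𝓗 : ℝ) ≤ 2 ^ ((n : ℝ) ^ (2 - δ)) := by
  -- With blocks of length b ≈ n^a the number t = (b + 1)^d of traces satisfies b·t ≤ n, so each
  -- block has at most (2n)^n possibilities. There are O(n^(1-a)) blocks, and the logarithm costs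
  -- n^(a/2), whence δ = a/2.
  set a : ℝ := 1 / (d + 1) with ha
  have ha0 : 0 < a := by positivity
  have ha1 : a ≤ 1 := by
    rw [ha, div_le_one (by positivity)]
    linarith [(Nat.cast_nonneg d : (0 : ℝ) ≤ d)]
  refine ⟨a / 2, by positivity, by linarith, ?_⟩
  -- The bound 4 makes b > x - 2 at least x/2.
  have hx : ∀ᶠ n : ℕ in atTop, (4 : ℝ) ≤ (n : ℝ) ^ a :=
    ((tendsto_rpow_atTop ha0).comp tendsto_natCast_atTop_atTop).eventually_ge_atTop 4
  filter_upwards [hx, eventually_three_mul_logb_le ha0, eventually_ge_atTop 1] with n hx hlog hn1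
  intro 𝓗 h𝓗
  have hn1' : (1 : ℝ) ≤ n := by exact_mod_cast hn1
  have hn0 : (0 : ℝ) < n := by linarith
  set x := (n : ℝ) ^ a with hxdef
  obtain ⟨b, hbm⟩ : ∃ b, ⌊x⌋₊ = b + 1 :=
    ⟨⌊x⌋₊ - 1, (Nat.sub_add_cancel (Nat.le_floor (by push_cast; linarith))).symm⟩
  have hbx : ((b + 1 : ℕ) : ℝ) ≤ x := hbm ▸ Nat.floor_le (by linarith)
  have hbx' : x / 2 ≤ b := by
    have := Nat.lt_floor_add_one x
    rw [hbm] at this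
    push_cast at this
    linarith
  have hb0 : (0 : ℝ) < b := by linarith
  have hb : 1 ≤ b := by exact_mod_cast hb0
  have hpow : (b + 1) ^ (d + 1) ≤ n := by
    have : ((b + 1 : ℕ) : ℝ) ^ (d + 1) ≤ n := by
      calc ((b + 1 : ℕ) : ℝ) ^ (d + 1) ≤ x ^ (d + 1) := by gcongr
        _ = n := by
          rw [hxdef, ← Real.rpow_mul_natCast hn0.le, ha]
          push_cast
          rw [one_div_mul_cancel (by positivity), Real.rpow_one]
    exact_mod_cast this
  have ht : (b + 1) ^ d ≤ n := (Nat.pow_le_pow_right (by omega) (by omega)).trans hpow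
  have hbt : b * (b + 1) ^ d ≤ n := by
    refine le_trans ?_ hpow
    rw [pow_succ, mul_comm]
    exact Nat.mul_le_mul_left _ (by omega)
  have hcard : #𝓗 ≤ (2 * n) ^ (n * (n / b + 1)) := by
    refine (card_le_of_shatters hb 𝓗 h𝓗).trans ?_
    rw [pow_mul]
    refine Nat.pow_le_pow_left ?_ _
    rw [← pow_mul, mul_pow]
    gcongr
    norm_num
  have hN : ((n * (n / b + 1) : ℕ) : ℝ) ≤ 3 * (n : ℝ) ^ (2 - a) := by
    have h1 : ((n / b : ℕ) : ℝ) ≤ 2 * (n / x) := by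
      refine Nat.cast_div_le.trans ?_
      rw [div_le_iff₀ hb0, mul_assoc, div_mul_eq_mul_div, ← mul_div_assoc,
        le_div_iff₀ (by linarith)]
      nlinarith
    have h2 : 1 ≤ n / x := by
      rw [one_le_div (by linarith)]
      calc x ≤ (n : ℝ) ^ (1 : ℝ) := Real.rpow_le_rpow_of_exponent_le hn1' ha1
        _ = n := Real.rpow_one _
    have h3 : (n : ℝ) ^ (2 - a) = n * (n / x) := by
      rw [Real.rpow_sub hn0, Real.rpow_two, sq, mul_div_assoc]
    rw [h3]
    push_cast
    nlinarith
  have hlog0 : 0 ≤ Real.logb 2 (2 * n) := Real.logb_nonneg (by norm_num) (by linarith)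
  calc (#𝓗 : ℝ) ≤ (2 * n : ℝ) ^ (n * (n / b + 1)) := by exact_mod_cast hcard
    _ = 2 ^ (Real.logb 2 (2 * n) * ((n * (n / b + 1) : ℕ) : ℝ)) := by
      rw [Real.rpow_mul_natCast (by norm_num), Real.rpow_logb (by norm_num) (by norm_num)
        (by positivity)]
    _ ≤ 2 ^ ((n : ℝ) ^ (2 - a / 2)) := by
      refine Real.rpow_le_rpow_of_exponent_le (by norm_num) ?_
      calc Real.logb 2 (2 * n) * ((n * (n / b + 1) : ℕ) : ℝ)
          ≤ Real.logb 2 (2 * n) * (3 * (n : ℝ) ^ (2 - a)) := by gcongr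
        _ = (3 * Real.logb 2 (2 * n)) * (n : ℝ) ^ (2 - a) := by ring
        _ ≤ (n : ℝ) ^ (a / 2) * (n : ℝ) ^ (2 - a) := by gcongr
        _ = (n : ℝ) ^ (2 - a / 2) := by rw [← Real.rpow_add hn0]; congr 1; ring

end SimpleGraph

/-! ### A substitute for independence, and the graphs with a prescribed inside. -/

namespace SimpleGraph

open Finset

/-- If each of the events `E j` can be forced by a map with fibres of size at most `M` that does not
affect the other events, then few elements avoid all these events. -/
theorem card_avoid_le {Ω κ : Type*} [DecidableEq Ω] (A : Finset Ω) (E : κ → Ω → Prop)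
    [∀ j, DecidablePred (E j)] (φ : κ → Ω → Ω) {M : ℕ} (hM : 1 ≤ M) (I : Finset κ)
    (hmaps : ∀ j ∈ I, ∀ x ∈ A, φ j x ∈ A) (hE : ∀ j ∈ I, ∀ x ∈ A, E j (φ j x))
    (hfib : ∀ j ∈ I, ∀ y ∈ A, #{x ∈ A | φ j x = y} ≤ M)
    (hother : ∀ j ∈ I, ∀ i ∈ I, i ≠ j → ∀ x ∈ A, E i (φ j x) → E i x) :
    (#{x ∈ A | ∀ j ∈ I, ¬ E j x} : ℝ) ≤ (1 - 1 / M) ^ #I * #A := by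
  classical
  induction I using Finset.induction_on with
  | empty => simp
  | insert j I hj ih =>
    have ih := ih (fun j h => hmaps j (mem_insert_of_mem h)) (fun j h => hE j (mem_insert_of_mem h))
      (fun j h => hfib j (mem_insert_of_mem h))
      (fun j h i hi => hother j (mem_insert_of_mem h) i (mem_insert_of_mem hi))
    have hjI := mem_insert_self j I
    set F : Finset Ω := {x ∈ A | ∀ i ∈ I, ¬ E i x} with hF
    have hsub : ({x ∈ A | ∀ i ∈ insert j I, ¬ E i x} : Finset Ω) = {x ∈ F | ¬ E j x} := by
      ext x
      simp only [hF, mem_filter, mem_insert, forall_eq_or_imp]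
      tauto
    -- Forcing `E j` creates none of the events already avoided, so `φ j` maps `F` into `F ∩ E j`,
    -- and `E j` holds on at least a fraction `1 / M` of `F`.
    have hle : #F ≤ M * #{x ∈ F | E j x} := by
      refine card_le_mul_card_image_of_maps_to (f := φ j) (fun x hx => ?_) M fun y hy => ?_
      · rw [mem_filter] at hx
        refine mem_filter.2 ⟨mem_filter.2 ⟨hmaps j hjI x hx.1, fun i hi h => hx.2 i hi ?_⟩,
          hE j hjI x hx.1⟩
        exact hother j hjI i (mem_insert_of_mem hi) (fun h => hj (h ▸ hi)) x hx.1 h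
      · refine le_trans (card_le_card fun x hx => ?_)
          (hfib j hjI y (mem_filter.1 (mem_filter.1 hy).1).1)
        rw [mem_filter] at hx ⊢
        exact ⟨(mem_filter.1 hx.1).1, hx.2⟩
    have hsum := card_filter_add_card_filter_not (s := F) (E j)
    have hM' : (1 : ℝ) ≤ M := by exact_mod_cast hM
    have hle' : (#F : ℝ) / M ≤ #{x ∈ F | E j x} := by
      rw [div_le_iff₀' (by linarith)]
      exact_mod_cast hle
    have hsum' : (#{x ∈ F | E j x} : ℝ) + #{x ∈ F | ¬ E j x} = #F := by exact_mod_cast hsum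
    have hpos : (0 : ℝ) ≤ 1 - 1 / M := by
      rw [sub_nonneg, div_le_one (by linarith)]
      exact hM'
    rw [hsub, card_insert_of_notMem hj, pow_succ']
    calc (#{x ∈ F | ¬ E j x} : ℝ) ≤ (1 - 1 / M) * #F := by
          rw [sub_mul, one_mul, one_div_mul_eq_div]
          linarith
      _ ≤ (1 - 1 / M) * ((1 - 1 / M) ^ #I * #A) := by gcongr
      _ = _ := by ring

variable {V ι : Type}

/-- The complete multipartite graph whose parts are the fibres of `p`. -/
def crossing (p : V → ι) : SimpleGraph V where
  Adj u w := p u ≠ p w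
  symm := ⟨fun _ _ h => h.symm⟩
  loopless := ⟨fun _ h => h rfl⟩

open scoped Classical in
/-- The graphs whose part inside the fibres of `p` is `H`. -/
noncomputable def fiberClass [Fintype V] (p : V → ι) (H : SimpleGraph V) :
    Finset (SimpleGraph V) :=
  {G | inside p G = H}

theorem mem_fiberClass [Fintype V] {p : V → ι} {H G : SimpleGraph V} :
    G ∈ fiberClass p H ↔ inside p G = H := by
  simp [fiberClass]

-- Given the inside, the graph is determined by its crossing edges.
open scoped Classical in
theorem card_fiberClass_le [Fintype V] (p : V → ι) (H : SimpleGraph V) :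
    #(fiberClass p H) ≤ 2 ^ #(crossing p).edgeFinset := by
  rw [← card_powerset]
  refine card_le_card_of_injOn (fun G => G.edgeFinset ∩ (crossing p).edgeFinset)
    (fun G _ => mem_coe.2 (mem_powerset.2 inter_subset_right)) ?_
  intro G hG G' hG' h
  have hG : inside p G = H := mem_fiberClass.1 hG
  have hG' : inside p G' = H := mem_fiberClass.1 hG'
  ext u w
  by_cases hp : p u = p w
  · have : (inside p G).Adj u w ↔ (inside p G').Adj u w := by rw [hG, hG']
    simpa [inside, hp] using this
  · have := congrArg (fun s => s(u, w) ∈ s) h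
    have hc : s(u, w) ∈ (crossing p).edgeFinset := by
      rw [mem_edgeFinset, mem_edgeSet]
      exact hp
    simpa only [mem_inter, hc, and_true, mem_edgeFinset, mem_edgeSet, eq_iff_iff] using this

-- Any set of crossing pairs can be added to `H` without changing the inside.
open scoped Classical in
theorem le_card_fiberClass [Fintype V] (p : V → ι) {H : SimpleGraph V} (hH : inside p H = H) :
    2 ^ #(crossing p).edgeFinset ≤ #(fiberClass p H) := by
  have hHp : ∀ u w, H.Adj u w → p u = p w := fun u w h => by
    rw [← hH] at h
    exact h.2
  rw [← card_powerset]
  refine card_le_card_of_injOn (fun D => H ⊔ fromEdgeSet (D : Set (Sym2 V))) (fun D hD => ?_) ?_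
  · rw [mem_coe, mem_powerset] at hD
    rw [mem_coe, mem_fiberClass]
    ext u w
    constructor
    · rintro ⟨h | h, hp⟩
      · exact h
      · have := hD (mem_coe.1 ((fromEdgeSet_adj _).1 h).1)
        rw [mem_edgeFinset, mem_edgeSet] at this
        exact absurd hp this
    · exact fun h => ⟨Or.inl h, hHp u w h⟩
  · have key : ∀ D D' : Finset (Sym2 V), D ⊆ (crossing p).edgeFinset →
        H ⊔ fromEdgeSet (D : Set (Sym2 V)) = H ⊔ fromEdgeSet (D' : Set (Sym2 V)) → D ⊆ D' := by
      intro D D' hD h e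
      induction e using Sym2.ind with
      | _ u w =>
      intro he
      have hc := hD he
      rw [mem_edgeFinset, mem_edgeSet] at hc
      have h1 : (H ⊔ fromEdgeSet (D : Set (Sym2 V))).Adj u w :=
        Or.inr ((fromEdgeSet_adj _).2 ⟨he, hc.ne⟩)
      rw [h] at h1
      rcases h1 with h1 | h1
      · exact absurd (hHp u w h1) hc
      · exact ((fromEdgeSet_adj _).1 h1).1
    intro D hD D' hD' h
    rw [mem_coe, mem_powerset] at hD hD'
    exact Subset.antisymm (key D D' hD h) (key D' D hD' h.symm)

/-- The number of pairs of vertices in distinct parts of a partition. -/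
theorem two_mul_card_crossing [Fintype V] [Fintype ι] [DecidableEq ι] (p : V → ι)
    [Fintype (crossing p).edgeSet] :
    2 * (#(crossing p).edgeFinset : ℝ) =
      (Fintype.card V : ℝ) ^ 2 - ∑ i, (#{v | p v = i} : ℝ) ^ 2 := by
  classical
  have hdeg : ∀ v, ((crossing p).degree v : ℝ) = Fintype.card V - #{w | p w = p v} := by
    intro v
    have h : (crossing p).neighborFinset v = ({w | ¬ p w = p v} : Finset V) := by
      ext w
      simp only [mem_neighborFinset, mem_filter, mem_univ, true_and]
      exact ⟨fun h => Ne.symm h, fun h => Ne.symm h⟩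
    have hsum := card_filter_add_card_filter_not (s := (univ : Finset V)) (fun w => p w = p v)
    rw [← card_neighborFinset_eq_degree, h, eq_sub_iff_add_eq, add_comm, ← card_univ, ← hsum]
    push_cast
    rfl
  have h := (crossing p).sum_degrees_eq_twice_card_edges
  have h' : (∑ v, ((crossing p).degree v : ℝ)) = 2 * (#(crossing p).edgeFinset : ℝ) := by
    rw [← Nat.cast_sum, h]
    push_cast
    congr!
  rw [← h']
  simp only [hdeg]
  rw [sum_sub_distrib, sum_const, card_univ, nsmul_eq_mul, sq]
  congr 1
  rw [← sum_fiberwise (s := univ) (g := p)]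
  refine sum_congr rfl fun i _ => ?_
  rw [sum_congr rfl (g := fun _ => (#{w | p w = i} : ℝ)), sum_const, nsmul_eq_mul, sq]
  intro v hv
  rw [(mem_filter.1 hv).2]

end SimpleGraph

/-! ### Splitting by random crossing edges, and rigidity of the partition. -/

namespace SimpleGraph

open Finset

variable {V ι : Type}

/-- Greedy extraction: since `k ≤ R`, each removal costs at most `R` vertices. -/
theorem exists_disjoint_homogeneous {k R : ℕ} (hkR : k ≤ R)
    (hR : ∀ {V : Type} (G : SimpleGraph V) (A : Finset V),
      R ≤ #A → ∃ B ⊆ A, #B = k ∧ G.IsHomogeneous (B : Set V)) (G : SimpleGraph V) (r : ℕ)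
    (A : Finset V) (hA : r * R ≤ #A) :
    ∃ f : Fin r → Finset V, (∀ a, f a ⊆ A ∧ #(f a) = k ∧ G.IsHomogeneous (f a : Set V)) ∧
      Pairwise fun a b => Disjoint (f a) (f b) := by
  classical
  induction r generalizing A with
  | zero => exact ⟨Fin.elim0, fun a => a.elim0, fun a => a.elim0⟩
  | succ r ih =>
    obtain ⟨B, hB, hBk, hhom⟩ := hR G A (by nlinarith)
    obtain ⟨f, hf, hd⟩ := ih (A \ B) (by rw [card_sdiff_of_subset hB, hBk, add_mul] at *; omega)
    refine ⟨Fin.cons B f, fun a => ?_, ?_⟩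
    · refine Fin.cases ⟨hB, hBk, hhom⟩ (fun a => ?_) a
      exact ⟨(hf a).1.trans sdiff_subset, (hf a).2⟩
    · have hBf : ∀ a, Disjoint B (f a) := fun a => disjoint_sdiff.mono_right (hf a).1
      intro a b
      refine Fin.cases ?_ (fun a => ?_) a <;> refine Fin.cases ?_ (fun b => ?_) b
      · exact fun h => absurd rfl h
      · exact fun _ => hBf b
      · exact fun _ => (hBf a).symm
      · exact fun h => hd fun h' => h (congrArg Fin.succ h')

/-- Change `G` on the pairs in `E` so that it agrees there with `P`. -/
def overwrite (G : SimpleGraph V) (E P : Set (Sym2 V)) : SimpleGraph V :=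
  fromEdgeSet ((G.edgeSet \ E) ∪ P)

theorem overwrite_adj_of_notMem {G : SimpleGraph V} {E P : Set (Sym2 V)} (hP : P ⊆ E) {u w : V}
    (h : s(u, w) ∉ E) : (G.overwrite E P).Adj u w ↔ G.Adj u w := by
  rw [overwrite, fromEdgeSet_adj]
  constructor
  · rintro ⟨h' | h', -⟩
    · exact h'.1
    · exact absurd (hP h') h
  · exact fun h' => ⟨Or.inl ⟨h', h⟩, h'.ne⟩

theorem overwrite_adj_of_mem {G : SimpleGraph V} {E P : Set (Sym2 V)} {u w : V} (hne : u ≠ w)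
    (h : s(u, w) ∈ E) : (G.overwrite E P).Adj u w ↔ s(u, w) ∈ P := by
  rw [overwrite, fromEdgeSet_adj]
  constructor
  · rintro ⟨h' | h', -⟩
    · exact absurd h h'.2
    · exact h'
  · exact fun h' => ⟨Or.inr h', hne⟩

open scoped Classical in
/-- Few graphs with prescribed inside avoid prescribed patterns on many disjoint sets of crossing
pairs. -/
theorem card_avoid_patterns_le [Fintype V] {κ : Type} (p : V → ι) (H : SimpleGraph V) (I : Finset κ)
    (E P : κ → Finset (Sym2 V)) {r : ℕ} (hP : ∀ j ∈ I, P j ⊆ E j)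
    (hE : ∀ j ∈ I, ∀ e ∈ E j, e ∈ (crossing p).edgeSet) (hr : ∀ j ∈ I, #(E j) ≤ r)
    (hdisj : ∀ i ∈ I, ∀ j ∈ I, i ≠ j → Disjoint (E i) (E j)) :
    (#{G ∈ fiberClass p H | ∀ j ∈ I, ¬ ∀ e ∈ E j, e ∈ G.edgeSet ↔ e ∈ P j} : ℝ) ≤
      (1 - 1 / (2 ^ r : ℕ)) ^ #I * #(fiberClass p H) := by
  refine card_avoid_le (fiberClass p H) (fun j G => ∀ e ∈ E j, e ∈ G.edgeSet ↔ e ∈ P j)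
    (fun j G => G.overwrite (E j) (P j)) Nat.one_le_two_pow I ?_ ?_ ?_ ?_
  · intro j hj G hG
    rw [mem_fiberClass] at hG ⊢
    rw [← hG]
    ext u w
    refine and_congr_left fun hp => overwrite_adj_of_notMem (coe_subset.2 (hP j hj)) fun h => ?_
    exact hE j hj _ h hp
  · intro j hj G _ e
    induction e using Sym2.ind with
    | _ u w =>
    intro he
    have hne : u ≠ w := fun h => hE j hj _ he (congrArg p h)
    exact overwrite_adj_of_mem hne (mem_coe.2 he)
  · intro j hj G' _
    -- Overwriting forgets only the pairs in `E j`, so a preimage is determined by its edges there.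
    refine le_trans ?_ (Nat.pow_le_pow_right two_pos (hr j hj))
    rw [← card_powerset]
    refine card_le_card_of_injOn (fun G => {e ∈ E j | e ∈ G.edgeSet})
      (fun G _ => mem_coe.2 (mem_powerset.2 (filter_subset _ _))) ?_
    intro G₁ h₁ G₂ h₂ h
    have h₁ := (mem_filter.1 h₁).2
    have h₂ := (mem_filter.1 h₂).2
    ext u w
    by_cases he : s(u, w) ∈ E j
    · have := congrArg (fun s => s(u, w) ∈ s) h
      simpa only [mem_filter, he, true_and, eq_iff_iff, mem_edgeSet] using this
    · rw [← overwrite_adj_of_notMem (coe_subset.2 (hP j hj)) (mem_coe.not.2 he), h₁, ← h₂,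
        overwrite_adj_of_notMem (coe_subset.2 (hP j hj)) (mem_coe.not.2 he)]
  · intro j hj i hi hij G _ h e
    induction e using Sym2.ind with
    | _ u w =>
    intro he
    rw [← h _ he, mem_edgeSet, mem_edgeSet]
    exact (overwrite_adj_of_notMem (coe_subset.2 (hP j hj))
      fun he' => Finset.disjoint_left.1 (hdisj i hi j hj hij) he he').symm

/-- This allows homogeneous sets to be chosen from `H` alone, before the crossing edges. -/
theorem isHomogeneous_of_inside {p : V → ι} {G G' : SimpleGraph V} (h : inside p G = inside p G')
    {i : ι} {A : Set V} (hA : ∀ v ∈ A, p v = i) (hom : G.IsHomogeneous A) :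
    G'.IsHomogeneous A := by
  have key : ∀ u ∈ A, ∀ w ∈ A, G.Adj u w ↔ G'.Adj u w := by
    intro u hu w hw
    have : (inside p G).Adj u w ↔ (inside p G').Adj u w := by rw [h]
    simpa [inside, hA u hu, hA w hw] using this
  rcases hom with hom | hom
  · exact Or.inl fun u hu w hw hne => (key u hu w hw).1 (hom hu hw hne)
  · exact Or.inr fun u hu w hw hne => fun h => hom hu hw hne ((key u hu w hw).2 h)

-- `Z` contains `r` disjoint homogeneous `2k`-sets determined by `H`. For each vertex of `S` and
-- each such set, adjacency to exactly a chosen half is a pattern on `2k` crossing pairs that forces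
-- a split; these `#S * r` sets of pairs are disjoint.
open scoped Classical in
theorem card_not_splits_le [Fintype V] {k R : ℕ} (hkR : 2 * k ≤ R)
    (hR : ∀ {V : Type} (G : SimpleGraph V) (A : Finset V),
      R ≤ #A → ∃ B ⊆ A, #B = 2 * k ∧ G.IsHomogeneous (B : Set V))
    (p : V → ι) {H : SimpleGraph V} (hH : inside p H = H) (i : ι) {S Z : Finset V}
    (hS : ∀ v ∈ S, p v ≠ i) (hZ : ∀ v ∈ Z, p v = i) {r : ℕ} (hr : r * R ≤ #Z) :
    (#{G ∈ fiberClass p H | ∀ v ∈ S, ¬ G.Splits k v Z} : ℝ) ≤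
      (1 - 1 / (2 ^ (2 * k) : ℕ)) ^ (#S * r) * #(fiberClass p H) := by
  obtain ⟨f, hf, hd⟩ := exists_disjoint_homogeneous hkR hR H r Z hr
  choose B hB hBk using fun a => exists_subset_card_eq (s := f a) (n := k)
    (by rw [(hf a).2.1]; omega)
  let E : V × Fin r → Finset (Sym2 V) := fun j => (f j.2).image fun w => s(j.1, w)
  let P : V × Fin r → Finset (Sym2 V) := fun j => (B j.2).image fun w => s(j.1, w)
  have hmain := card_avoid_patterns_le p H (S ×ˢ (univ : Finset (Fin r))) E P (r := 2 * k) ?_ ?_ ?_ ?_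
  · rw [card_product, card_univ, Fintype.card_fin] at hmain
    refine le_trans ?_ hmain
    refine Nat.cast_le.2 (card_le_card fun G hG => ?_)
    simp only [mem_filter] at hG ⊢
    refine ⟨hG.1, fun j hj hpat => hG.2 j.1 (mem_product.1 hj).1 ?_⟩
    have hvZ : j.1 ∉ Z := fun h => hS _ (mem_product.1 hj).1 (hZ _ h)
    have hin : inside p H = inside p G := hH.trans (mem_fiberClass.1 hG.1).symm
    have hadj : ∀ w ∈ f j.2, G.Adj j.1 w ↔ w ∈ B j.2 := by
      intro w hw
      have := hpat s(j.1, w) (mem_image_of_mem _ hw)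
      rw [mem_edgeSet] at this
      rw [this]
      simp only [P, mem_image]
      constructor
      · rintro ⟨w', hw', h⟩
        rwa [← Sym2.congr_right.1 h]
      · exact fun h => ⟨w, h, rfl⟩
    refine ⟨B j.2, f j.2 \ B j.2, hBk _, ?_, disjoint_sdiff,
      coe_subset.2 ((hB _).trans (hf _).1), coe_subset.2 (sdiff_subset.trans (hf _).1), ?_,
      fun w hw => (hadj w (hB _ hw)).2 hw, fun w hw => ?_⟩
    · rw [card_sdiff_of_subset (hB _), (hf _).2.1, hBk]
      omega
    · rw [← coe_union, union_sdiff_of_subset (hB _)]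
      exact isHomogeneous_of_inside hin (fun v hv => hZ v ((hf _).1 hv)) (hf _).2.2
    · rw [mem_sdiff] at hw
      exact ⟨fun h => hvZ (h ▸ (hf _).1 hw.1), fun h => hw.2 ((hadj w hw.1).1 h)⟩
  · exact fun j _ => image_subset_image (hB _)
  · intro j hj e he
    obtain ⟨w, hw, rfl⟩ := mem_image.1 he
    rw [mem_edgeSet]
    change p _ ≠ p _
    rw [hZ w ((hf _).1 hw)]
    exact hS _ (mem_product.1 hj).1
  · exact fun j _ => card_image_le.trans (hf _).2.1.le
  · rintro ⟨v, a⟩ hva ⟨v', a'⟩ hva' hne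
    rw [Finset.disjoint_left]
    intro e he he'
    obtain ⟨w, hw, rfl⟩ := mem_image.1 he
    obtain ⟨w', hw', h⟩ := mem_image.1 he'
    have hpv := hS _ (mem_product.1 hva).1
    have hpw := hZ w ((hf _).1 hw)
    have hpv' := hS _ (mem_product.1 hva').1
    have hpw' := hZ w' ((hf _).1 hw')
    rcases Sym2.eq_iff.1 h with ⟨h1, h2⟩ | ⟨h1, h2⟩
    · dsimp only at h1 h2 hw hw'
      subst h1 h2
      have : a ≠ a' := fun h => hne (by rw [h])
      exact Finset.disjoint_left.1 (hd this) hw hw'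
    · dsimp only at h1 hpv'
      exact hpv' (h1 ▸ hpw)

-- By pigeonhole each part `i` of `p` shares at least `m` vertices with some part `τ i` of `q`. That
-- part of `q` has fewer than `s` vertices from elsewhere, since one of them would split the shared
-- set. As `s ≤ m`, `τ` is injective, hence bijective. So part `i` lies in `τ i` up to boundedly
-- many vertices, and any remaining foreign vertex in `τ i` would split what is left.
open scoped Classical in
theorem exists_perm_of_splits [Fintype V] [Fintype ι] {k m s : ℕ} {p : V → ι} {G : SimpleGraph V}
    (hsm : s ≤ m) (hp : ∀ i, Fintype.card ι * m ≤ #{v | p v = i})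
    (hlarge : ∀ i, ∀ S Z : Finset V, (∀ v ∈ S, p v ≠ i) → (∀ v ∈ Z, p v = i) → s ≤ #S → m ≤ #Z →
      ∃ v ∈ S, G.Splits k v Z)
    (hsmall : ∀ v, ∀ i, p v ≠ i → ∀ W : Finset V, #W ≤ Fintype.card ι * s →
      G.Splits k v ({w | p w = i ∧ w ∉ W} : Finset V))
    {q : V → ι} (hq : ∀ v, ¬ G.Splits k v {w | q w = q v}) :
    ∃ τ : Equiv.Perm ι, ∀ v, q v = τ (p v) := by
  have hmono : ∀ v, ∀ Z : Finset V, (∀ w ∈ Z, q w = q v) → ¬ G.Splits k v Z := by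
    rintro v Z hZ ⟨B, C, hB, hC, hBC, hBZ, hCZ, h⟩
    exact hq v ⟨B, C, hB, hC, hBC, fun w hw => hZ w (hBZ hw), fun w hw => hZ w (hCZ hw), h⟩
  have hex : ∀ i, ∃ j, m ≤ #{v | p v = i ∧ q v = j} := by
    intro i
    by_contra! h
    have hcard := card_eq_sum_card_fiberwise (s := ({v | p v = i} : Finset V)) (t := univ) (f := q)
      (fun _ _ => mem_coe.2 (mem_univ _))
    have hlt : ∑ j, #{v ∈ ({v | p v = i} : Finset V) | q v = j} < ∑ _j : ι, m := by
      refine sum_lt_sum_of_nonempty ⟨i, mem_univ i⟩ fun j _ => ?_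
      rw [filter_filter]
      exact h j
    rw [← hcard, sum_const, card_univ, smul_eq_mul] at hlt
    exact absurd (hp i) (by omega)
  choose τ hτ using hex
  have hfew : ∀ i, #{v | q v = τ i ∧ p v ≠ i} < s := by
    intro i
    by_contra! h
    obtain ⟨v, hv, hsp⟩ := hlarge i {v | q v = τ i ∧ p v ≠ i} {v | p v = i ∧ q v = τ i}
      (fun v hv => (mem_filter.1 hv).2.2) (fun v hv => (mem_filter.1 hv).2.1) h (hτ i)
    refine hmono v _ (fun w hw => ?_) hsp
    rw [(mem_filter.1 hw).2.2, (mem_filter.1 hv).2.1]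
  have hinj : Function.Injective τ := by
    intro i i' h
    by_contra hne
    have hsub : ({v | p v = i' ∧ q v = τ i'} : Finset V) ⊆
        ({v | q v = τ i ∧ p v ≠ i} : Finset V) := by
      intro v hv
      rw [mem_filter] at hv ⊢
      exact ⟨hv.1, hv.2.2.trans h.symm, fun h' => hne (h'.symm.trans hv.2.1)⟩
    exact absurd ((hτ i').trans (card_le_card hsub)) (by have := hfew i; omega)
  have hsurj : Function.Surjective τ := Finite.injective_iff_surjective.1 hinj
  have hsubset : ∀ v i, q v = τ i → p v = i := by
    intro v i hv
    by_contra hne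
    -- By surjectivity each such vertex lies in some `τ i'` with `i' ≠ i`, where it is foreign.
    have hW : #{w | p w = i ∧ q w ≠ τ i} ≤ Fintype.card ι * s := by
      have hsub : ({w | p w = i ∧ q w ≠ τ i} : Finset V) ⊆
          univ.biUnion fun i' => ({w | q w = τ i' ∧ p w ≠ i'} : Finset V) := by
        intro w hw
        rw [mem_filter] at hw
        obtain ⟨i', hi'⟩ := hsurj (q w)
        refine mem_biUnion.2 ⟨i', mem_univ _, mem_filter.2 ⟨mem_univ _, hi'.symm, fun h => ?_⟩⟩
        rw [hw.2.1] at h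
        exact hw.2.2 (by rw [h, hi'])
      refine (card_le_card hsub).trans (card_biUnion_le.trans ?_)
      refine (sum_le_sum fun i _ => (hfew i).le).trans ?_
      simp
    refine hmono v _ (fun w hw => ?_) (hsmall v i hne _ hW)
    simp only [mem_filter, mem_univ, true_and, not_and, not_not] at hw
    rw [hw.2 hw.1, hv]
  refine ⟨Equiv.ofBijective τ ⟨hinj, hsurj⟩, fun v => ?_⟩
  obtain ⟨i, hi⟩ := hsurj (q v)
  change q v = τ (p v)
  rw [hsubset v i hi.symm, hi]

end SimpleGraph

/-! ### The proportion of ambiguous graphs. -/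

namespace SimpleGraph

open Finset Filter

variable {V ι : Type}

/-- Some partition, none of whose parts is split by one of its vertices, is not obtained from `p`
by permuting the parts. -/
def IsAmbiguous (k : ℕ) (G : SimpleGraph V) (p : V → ι) : Prop :=
  ∃ q : V → ι, (∀ v, ¬ G.Splits k v {w | q w = q v}) ∧ ¬ ∃ τ : Equiv.Perm ι, ∀ v, q v = τ (p v)

theorem card_card_le [Fintype V] [Nonempty V] (m : ℕ) :
    #{W : Finset V | #W ≤ m} ≤ (Fintype.card V + 1) ^ (m + 1) := by
  classical
  have hn : 1 ≤ Fintype.card V := Fintype.card_pos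
  have hsub : ({W : Finset V | #W ≤ m} : Finset (Finset V)) ⊆
      (range (m + 1)).biUnion fun i => powersetCard i univ := by
    intro W hW
    simp only [mem_filter, mem_univ, true_and] at hW
    simpa [Nat.lt_succ_iff] using hW
  refine (card_le_card hsub).trans (card_biUnion_le.trans ?_)
  calc ∑ i ∈ range (m + 1), #(powersetCard i (univ : Finset V))
      ≤ ∑ i ∈ range (m + 1), (Fintype.card V + 1) ^ i := by
        gcongr with i hi
        rw [card_powersetCard, card_univ]
        exact (Nat.choose_le_pow _ i).trans (Nat.pow_le_pow_left (by omega) _)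
    _ ≤ _ := (Nat.geomSum_lt (by omega) (by simp)).le

-- Union bound over the failures of the two hypotheses of `exists_perm_of_splits`: at most l·4^n
-- triples (i, S, Z), and polynomially many triples (v, i, W) when `s` is constant. The second size
-- condition leaves `r * R` vertices in a part after `W` is deleted.
open scoped Classical in
theorem card_isAmbiguous_le [Fintype V] [Nonempty V] [Fintype ι] {k R : ℕ} (hkR : 2 * k ≤ R)
    (hR : ∀ {V : Type} (G : SimpleGraph V) (A : Finset V),
      R ≤ #A → ∃ B ⊆ A, #B = 2 * k ∧ G.IsHomogeneous (B : Set V))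
    {p : V → ι} {H : SimpleGraph V} (hH : inside p H = H) {r s : ℕ} (hs : s ≤ r * R)
    (hp : ∀ i, Fintype.card ι * (r * R) ≤ #{v | p v = i})
    (hp' : ∀ i, r * R + Fintype.card ι * s ≤ #{v | p v = i}) :
    (#{G ∈ fiberClass p H | IsAmbiguous k G p} : ℝ) ≤
      (Fintype.card ι * 4 ^ Fintype.card V * (1 - 1 / (2 ^ (2 * k) : ℕ)) ^ (s * r) +
        Fintype.card V * Fintype.card ι * (Fintype.card V + 1) ^ (Fintype.card ι * s + 1) *
          (1 - 1 / (2 ^ (2 * k) : ℕ)) ^ r) * #(fiberClass p H) := by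
  set c : ℝ := 1 - 1 / (2 ^ (2 * k) : ℕ) with hc
  have hM : (1 : ℝ) ≤ (2 ^ (2 * k) : ℕ) := by exact_mod_cast Nat.one_le_two_pow
  have hc0 : 0 ≤ c := by
    rw [hc, sub_nonneg, div_le_one (by linarith)]
    exact hM
  have hc1 : c ≤ 1 := by
    rw [hc, sub_le_self_iff]
    positivity
  let avoid : Finset V → Finset V → Finset (SimpleGraph V) :=
    fun S Z => {G ∈ fiberClass p H | ∀ v ∈ S, ¬ G.Splits k v Z}
  let I₁ : Finset (ι × Finset V × Finset V) :=
    {x | (∀ v ∈ x.2.1, p v ≠ x.1) ∧ (∀ v ∈ x.2.2, p v = x.1) ∧ s ≤ #x.2.1 ∧ r * R ≤ #x.2.2}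
  let I₂ : Finset (V × ι × Finset V) :=
    (univ ×ˢ univ ×ˢ ({W : Finset V | #W ≤ Fintype.card ι * s} : Finset (Finset V))).filter
      fun x => p x.1 ≠ x.2.1
  let Z : ι → Finset V → Finset V := fun i W => {w | p w = i ∧ w ∉ W}
  have hsub : ({G ∈ fiberClass p H | IsAmbiguous k G p} : Finset (SimpleGraph V)) ⊆
      (I₁.biUnion fun x => avoid x.2.1 x.2.2) ∪ I₂.biUnion fun x => avoid {x.1} (Z x.2.1 x.2.2) := by
    intro G hG
    obtain ⟨hG, q, hq, hqτ⟩ := mem_filter.1 hG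
    by_contra hcon
    rw [mem_union, not_or, mem_biUnion, mem_biUnion] at hcon
    obtain ⟨h₁, h₂⟩ := hcon
    push Not at h₁ h₂
    refine hqτ (exists_perm_of_splits hs hp ?_ ?_ hq)
    · intro i S Z hS hZ hSs hZr
      by_contra! h
      exact h₁ (i, S, Z) (by simp only [I₁, mem_filter, mem_univ, true_and]; exact ⟨hS, hZ, hSs, hZr⟩)
        (mem_filter.2 ⟨hG, h⟩)
    · intro v i hv W hW
      by_contra h
      refine h₂ (v, i, W) ?_ (mem_filter.2 ⟨hG, fun u hu => ?_⟩)
      · simp only [I₂, mem_filter, mem_product, mem_univ, true_and]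
        exact ⟨hW, hv⟩
      · rw [mem_singleton.1 hu]
        exact h
  have hb₁ : (#(I₁.biUnion fun x => avoid x.2.1 x.2.2) : ℝ) ≤
      Fintype.card ι * 4 ^ Fintype.card V * (c ^ (s * r) * #(fiberClass p H)) := by
    calc (#(I₁.biUnion fun x => avoid x.2.1 x.2.2) : ℝ)
        ≤ ∑ x ∈ I₁, (#(avoid x.2.1 x.2.2) : ℝ) := by exact_mod_cast card_biUnion_le
      _ ≤ ∑ _x ∈ I₁, c ^ (s * r) * #(fiberClass p H) := by
        refine sum_le_sum fun x hx => ?_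
        simp only [I₁, mem_filter, mem_univ, true_and] at hx
        refine (card_not_splits_le hkR hR p hH x.1 hx.1 hx.2.1 hx.2.2.2).trans ?_
        refine mul_le_mul_of_nonneg_right ?_ (by positivity)
        exact pow_le_pow_of_le_one hc0 hc1 (Nat.mul_le_mul_right _ hx.2.2.1)
      _ ≤ _ := by
        rw [sum_const, nsmul_eq_mul]
        refine mul_le_mul_of_nonneg_right ?_ (by positivity)
        have : #I₁ ≤ Fintype.card ι * 4 ^ Fintype.card V := by
          refine (card_filter_le _ _).trans_eq ?_
          rw [card_univ, Fintype.card_prod, Fintype.card_prod, Fintype.card_finset, ← mul_pow]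
          norm_num
        exact_mod_cast this
  have hb₂ : (#(I₂.biUnion fun x => avoid {x.1} (Z x.2.1 x.2.2)) : ℝ) ≤
      Fintype.card V * Fintype.card ι * (Fintype.card V + 1) ^ (Fintype.card ι * s + 1) *
        (c ^ r * #(fiberClass p H)) := by
    calc (#(I₂.biUnion fun x => avoid {x.1} (Z x.2.1 x.2.2)) : ℝ)
        ≤ ∑ x ∈ I₂, (#(avoid {x.1} (Z x.2.1 x.2.2)) : ℝ) := by exact_mod_cast card_biUnion_le
      _ ≤ ∑ _x ∈ I₂, c ^ r * #(fiberClass p H) := by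
        refine sum_le_sum fun x hx => ?_
        simp only [I₂, mem_filter, mem_product, mem_univ, true_and] at hx
        have hZr : r * R ≤ #(Z x.2.1 x.2.2) := by
          have h1 : ({v | p v = x.2.1} : Finset V) ⊆ Z x.2.1 x.2.2 ∪ x.2.2 := by
            intro w hw
            rw [mem_filter] at hw
            by_cases h : w ∈ x.2.2
            · exact mem_union_right _ h
            · exact mem_union_left _ (mem_filter.2 ⟨mem_univ _, hw.2, h⟩)
          have h2 := (card_le_card h1).trans (card_union_le _ _)
          have h3 := hp' x.2.1
          omega
        have h := card_not_splits_le hkR hR p hH x.2.1 (S := {x.1}) (Z := Z x.2.1 x.2.2)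
          (fun v hv => by rw [mem_singleton.1 hv]; exact hx.2)
          (fun v hv => (mem_filter.1 hv).2.1) hZr
        rwa [card_singleton, one_mul] at h
      _ ≤ _ := by
        rw [sum_const, nsmul_eq_mul]
        refine mul_le_mul_of_nonneg_right ?_ (by positivity)
        have : #I₂ ≤
            Fintype.card V * Fintype.card ι * (Fintype.card V + 1) ^ (Fintype.card ι * s + 1) := by
          refine (card_filter_le _ _).trans ?_
          rw [card_product, card_product, card_univ, card_univ, mul_assoc]
          gcongr
          exact card_card_le _
        exact_mod_cast this
  have h : (#{G ∈ fiberClass p H | IsAmbiguous k G p} : ℝ) ≤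
      #(I₁.biUnion fun x => avoid x.2.1 x.2.2) +
        #(I₂.biUnion fun x => avoid {x.1} (Z x.2.1 x.2.2)) := by
    exact_mod_cast (card_le_card hsub).trans (card_union_le _ _)
  linarith

/-- The bound on the proportion of ambiguous graphs tends to zero. -/
theorem exists_tendsto_ambiguity_bound (l : ℕ) {K : ℕ} (hK : 1 ≤ K) {c : ℝ} (hc0 : 0 < c)
    (hc1 : c < 1) : ∃ s : ℕ, Tendsto (fun n : ℕ => (l : ℝ) * 4 ^ n * c ^ (s * (n / K)) +
      n * l * (n + 1) ^ (l * s + 1) * c ^ (n / K)) atTop (nhds 0) := by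
  -- With r = n / K one has 4^n ≤ 4^K·(4^K)^r, so this constant `s` makes the first term O(2^(-r)).
  obtain ⟨s, hs⟩ : ∃ s : ℕ, c ^ s < 1 / (2 * 4 ^ K) :=
    exists_pow_lt_of_lt_one (by positivity) hc1
  refine ⟨s, ?_⟩
  set m := l * s + 1
  have hr : Tendsto (fun n : ℕ => n / K) atTop atTop := Nat.tendsto_div_const_atTop (by omega)
  have h₁ : Tendsto (fun r : ℕ => (l : ℝ) * 4 ^ K * (1 / 2) ^ r) atTop (nhds 0) := by
    simpa using (tendsto_pow_atTop_nhds_zero_of_lt_one (by norm_num : (0 : ℝ) ≤ 1 / 2)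
      (by norm_num)).const_mul ((l : ℝ) * 4 ^ K)
  have h₂ : Tendsto (fun r : ℕ => (l : ℝ) * (2 * K) ^ (m + 1) * c⁻¹ *
      (((r + 1 : ℕ) : ℝ) ^ (m + 1) * c ^ (r + 1))) atTop (nhds 0) := by
    have := (tendsto_add_atTop_iff_nat 1).2 (tendsto_pow_const_mul_const_pow_of_abs_lt_one (m + 1)
      (show |c| < 1 by rwa [abs_of_pos hc0]))
    simpa using this.const_mul ((l : ℝ) * (2 * K) ^ (m + 1) * c⁻¹)
  have h := (h₁.add h₂).comp hr
  rw [add_zero] at h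
  refine squeeze_zero (fun n => by positivity) (fun n => ?_) h
  have hn : n ≤ K * (n / K + 1) := by
    have := Nat.div_add_mod n K
    have := Nat.mod_lt n (show 0 < K by omega)
    rw [mul_add]
    omega
  dsimp only [Function.comp]
  generalize n / K = r at hn ⊢
  refine add_le_add ?_ ?_
  · rw [mul_assoc, mul_assoc]
    refine mul_le_mul_of_nonneg_left ?_ (by positivity)
    calc (4 : ℝ) ^ n * c ^ (s * r) ≤ 4 ^ (K * (r + 1)) * c ^ (s * r) := by
          gcongr
          norm_num
      _ = 4 ^ K * (4 ^ K * c ^ s) ^ r := by ring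
      _ ≤ 4 ^ K * (1 / 2) ^ r := by
          gcongr
          rw [lt_div_iff₀ (by positivity)] at hs
          linarith
  · have hn' : ((n + 1 : ℕ) : ℝ) ≤ 2 * K * (r + 1 : ℕ) := by
      have : n + 1 ≤ 2 * K * (r + 1) := by nlinarith
      exact_mod_cast this
    calc (n : ℝ) * l * (n + 1) ^ m * c ^ r = l * (n * (n + 1) ^ m) * c ^ r := by ring
      _ ≤ l * ((n + 1 : ℕ) : ℝ) ^ (m + 1) * c ^ r := by
          gcongr
          rw [pow_succ' _ m]
          push_cast
          gcongr
          linarith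
      _ ≤ l * (2 * K * (r + 1 : ℕ)) ^ (m + 1) * c ^ r := by gcongr
      _ = _ := by
          rw [mul_pow, pow_succ c r]
          field_simp

end SimpleGraph

/-! ### Counting the graphs with a given partition. -/

namespace GraphFamily

open SimpleGraph Finset Filter

variable {V ι : Type}

/-- The fibres of `p` form a `𝒯`-partition of `G`. -/
def IsPartitionMap [Finite V] (𝒯 : ι → GraphFamily) (G : SimpleGraph V) (p : V → ι) : Prop :=
  ∀ i, (𝒯 i).Mem (G.induce {v | p v = i})

theorem IsPartitionMap.isPartition [Finite V] {𝒯 : ι → GraphFamily} {G : SimpleGraph V} {p : V → ι}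
    (h : IsPartitionMap 𝒯 G p) : IsPartition 𝒯 G fun i => {v | p v = i} where
  disjoint i j hij := Set.disjoint_left.2 fun v hi hj => hij (hi.symm.trans hj)
  cover := by
    ext v
    simp
  mem := h

theorem IsPartition.exists_map [Finite V] {𝒯 : ι → GraphFamily} {G : SimpleGraph V}
    {X : ι → Set V} (h : IsPartition 𝒯 G X) :
    ∃ p : V → ι, IsPartitionMap 𝒯 G p ∧ X = fun i => {v | p v = i} := by
  have hex : ∀ v, ∃ i, v ∈ X i := fun v => Set.mem_iUnion.1 (by rw [h.cover]; trivial)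
  choose p hp using hex
  have hX : X = fun i => {v | p v = i} := by
    funext i
    ext v
    refine ⟨fun hv => ?_, fun hv => hv ▸ hp v⟩
    by_contra hne
    exact Set.disjoint_left.1 (h.disjoint _ _ hne) (hp v) hv
  subst hX
  exact ⟨p, h.mem, rfl⟩

theorem IsPartitionMap.congr [Finite V] {𝒯 : ι → GraphFamily} {G G' : SimpleGraph V} {p : V → ι}
    (hG : inside p G = inside p G') (h : IsPartitionMap 𝒯 G p) : IsPartitionMap 𝒯 G' p := by
  intro i
  have : G'.induce {v | p v = i} = G.induce {v | p v = i} := by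
    ext ⟨u, hu⟩ ⟨w, hw⟩
    have hadj : (inside p G).Adj u w ↔ (inside p G').Adj u w := by rw [hG]
    have hp : p u = p w := Eq.trans hu (Eq.symm hw)
    simp only [inside, hp, and_true] at hadj
    exact hadj.symm
  rw [this]
  exact h i

/-- No vertex splits a part of a `𝒯`-partition. -/
def IsUnsplit (k : ℕ) (𝒯 : ι → GraphFamily) : Prop :=
  ∀ {V : Type} [Finite V] (G : SimpleGraph V) (p : V → ι), IsPartitionMap 𝒯 G p →
    ∀ v, ¬ G.Splits k v {w | p w = p v}

theorem exists_isUnsplit [Fintype ι] {𝒯 : ι → GraphFamily} (hered : ∀ i, (𝒯 i).IsHereditary)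
    (meager : ∀ i, (𝒯 i).IsMeager) (hone : ∀ i, 1 ≤ (𝒯 i).coloringNumber) :
    ∃ k ≥ 2, IsUnsplit k 𝒯 := by
  choose k hk using fun i => (meager i).exists_not_splits (hered i) (hone i)
  refine ⟨univ.sup k + 2, by omega, fun {V} _ G p hp v => ?_⟩
  exact hk (p v) _ ((le_sup (mem_univ (p v))).trans (by omega)) G _ (hp _) v rfl

open scoped Classical in
/-- The graphs for which the fibres of `p` form a `𝒯`-partition. -/
noncomputable def partitionedBy [Fintype V] (𝒯 : ι → GraphFamily) (p : V → ι) :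
    Finset (SimpleGraph V) :=
  {G | IsPartitionMap 𝒯 G p}

theorem mem_partitionedBy [Fintype V] {𝒯 : ι → GraphFamily} {p : V → ι} {G : SimpleGraph V} :
    G ∈ partitionedBy 𝒯 p ↔ IsPartitionMap 𝒯 G p := by
  simp [partitionedBy]

theorem inside_inside (p : V → ι) (G : SimpleGraph V) : inside p (inside p G) = inside p G := by
  ext u w
  simp [inside]

-- Being partitioned by `p` depends only on the inside, so `partitionedBy 𝒯 p` is a union of whole
-- classes, and proportions can be bounded class by class.
open scoped Classical in
theorem filter_partitionedBy_inside [Fintype V] {𝒯 : ι → GraphFamily} {p : V → ι}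
    {G : SimpleGraph V} (hG : G ∈ partitionedBy 𝒯 p) :
    ({G' ∈ partitionedBy 𝒯 p | inside p G' = inside p G} : Finset (SimpleGraph V)) =
      fiberClass p (inside p G) := by
  ext G'
  rw [mem_filter, mem_fiberClass, mem_partitionedBy, and_iff_right_iff_imp]
  exact fun h => (mem_partitionedBy.1 hG).congr h.symm

open scoped Classical in
theorem card_filter_partitionedBy_le [Fintype V] (𝒯 : ι → GraphFamily) (p : V → ι)
    (Q : SimpleGraph V → Prop) {c : ℝ} (hQ : ∀ H, inside p H = H →
      (#{G ∈ fiberClass p H | Q G} : ℝ) ≤ c * #(fiberClass p H)) :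
    (#{G ∈ partitionedBy 𝒯 p | Q G} : ℝ) ≤ c * #(partitionedBy 𝒯 p) := by
  set 𝓗 := (partitionedBy 𝒯 p).image (inside p)
  have hmaps : Set.MapsTo (inside p) (partitionedBy 𝒯 p : Set (SimpleGraph V)) 𝓗 :=
    fun G hG => mem_coe.2 (mem_image_of_mem _ hG)
  have hmaps' : Set.MapsTo (inside p)
      ({G ∈ partitionedBy 𝒯 p | Q G} : Finset (SimpleGraph V)) 𝓗 :=
    fun G hG => hmaps (mem_filter.1 hG).1
  rw [card_eq_sum_card_fiberwise hmaps, card_eq_sum_card_fiberwise hmaps']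
  push_cast
  rw [mul_sum]
  refine sum_le_sum fun H hH => ?_
  obtain ⟨G, hG, rfl⟩ := mem_image.1 hH
  rw [filter_partitionedBy_inside hG, filter_filter]
  refine le_trans (Nat.cast_le.2 (card_le_card fun G' hG' => ?_))
    (hQ _ (inside_inside p G))
  rw [mem_filter] at hG' ⊢
  exact ⟨mem_fiberClass.2 hG'.2.2, hG'.2.1⟩

open scoped Classical in
theorem card_partitionedBy_le [Fintype V] (𝒯 : ι → GraphFamily) (p : V → ι) :
    #(partitionedBy 𝒯 p) ≤
      2 ^ #(crossing p).edgeFinset * #((partitionedBy 𝒯 p).image (inside p)) := by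
  refine card_le_mul_card_image _ _ fun H hH => ?_
  obtain ⟨G, hG, rfl⟩ := mem_image.1 hH
  rw [filter_partitionedBy_inside hG]
  exact card_fiberClass_le p _

open scoped Classical in
/-- The graphs partitioned by `p` are essentially determined by the pairs between the parts. -/
theorem IsUnsplit.exists_card_partitionedBy_le {𝒯 : ι → GraphFamily} {k : ℕ} (hk : 2 ≤ k)
    (h𝒯 : IsUnsplit k 𝒯) : ∃ δ : ℝ, 0 < δ ∧ δ < 1 ∧ ∀ᶠ n : ℕ in atTop, ∀ p : Fin n → ι,
      (#(partitionedBy 𝒯 p) : ℝ) ≤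
        2 ^ (#(crossing p).edgeFinset : ℝ) * 2 ^ ((n : ℝ) ^ (2 - δ)) := by
  obtain ⟨R, -, hR⟩ := exists_homogeneous (2 * k)
  obtain ⟨δ, h0, h1, h⟩ := exists_card_le_two_rpow R
  refine ⟨δ, h0, h1, h.mono fun n hn p => ?_⟩
  have hle : (#(partitionedBy 𝒯 p) : ℝ) ≤
      2 ^ (#(crossing p).edgeFinset : ℝ) * #((partitionedBy 𝒯 p).image (inside p)) := by
    rw [Real.rpow_natCast]
    exact_mod_cast card_partitionedBy_le 𝒯 p
  refine hle.trans (mul_le_mul_of_nonneg_left (hn _ fun H hH A hA => ?_) (by positivity))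
  obtain ⟨G, hG, rfl⟩ := mem_image.1 hH
  exact card_lt_of_shatters_inside hk hR p G (h𝒯 G p (mem_partitionedBy.1 hG)) hA

-- Fill each part with an edgeless or a complete graph, whichever its family allows; the crossing
-- pairs stay free.
open scoped Classical in
theorem two_pow_le_card_partitionedBy [Fintype V] {𝒯 : ι → GraphFamily}
    (hbase : ∀ i, Subfamily edgeless (𝒯 i) ∨ Subfamily complete (𝒯 i)) (p : V → ι) :
    2 ^ #(crossing p).edgeFinset ≤ #(partitionedBy 𝒯 p) := by
  let H : SimpleGraph V :=
    { Adj := fun u w => u ≠ w ∧ p u = p w ∧ ¬ Subfamily edgeless (𝒯 (p u))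
      symm := ⟨fun u w h => ⟨h.1.symm, h.2.1.symm, h.2.1 ▸ h.2.2⟩⟩
      loopless := ⟨fun _ h => h.1 rfl⟩ }
  have hH : inside p H = H := by
    ext u w
    exact ⟨fun h => h.1, fun h => ⟨h, h.2.1⟩⟩
  refine (le_card_fiberClass p hH).trans (card_le_card fun G hG => ?_)
  rw [mem_fiberClass] at hG
  refine mem_partitionedBy.2 (IsPartitionMap.congr (hH.trans hG.symm) fun i => ?_)
  by_cases hi : Subfamily edgeless (𝒯 i)
  · refine hi _ ?_
    change SimpleGraph.induce _ _ = ⊥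
    ext ⟨u, hu⟩ ⟨w, hw⟩
    refine iff_of_false (fun h => h.2.2 ?_) (fun h => h)
    have hu' : p u = i := hu
    change Subfamily edgeless (𝒯 (p u))
    rwa [hu']
  · refine (hbase i).resolve_left hi _ ?_
    change SimpleGraph.induce _ _ = ⊤
    ext ⟨u, hu⟩ ⟨w, hw⟩
    have hu' : p u = i := hu
    have hw' : p w = i := hw
    simp [H, hu', hw', hi]

/-- Makes the cost of imbalance explicit: half the sum of the squared deviations. -/
theorem two_mul_card_crossing_eq {n l : ℕ} (hl : 1 ≤ l) (p : Fin n → Fin l)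
    [Fintype (crossing p).edgeSet] :
    2 * (#(crossing p).edgeFinset : ℝ) =
      (n : ℝ) ^ 2 - (n : ℝ) ^ 2 / l - ∑ i, ((#{v | p v = i} : ℝ) - n / l) ^ 2 := by
  have hl' : (l : ℝ) ≠ 0 := by positivity
  have hsum : ∑ i, (#{v | p v = i} : ℝ) = n := by
    have := card_eq_sum_card_fiberwise (s := (univ : Finset (Fin n))) (t := univ) (f := p)
      (fun _ _ => mem_coe.2 (mem_univ _))
    rw [card_univ, Fintype.card_fin] at this
    exact_mod_cast this.symm
  rw [two_mul_card_crossing, Fintype.card_fin]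
  simp only [sub_sq, sum_add_distrib, sum_sub_distrib, sum_const, card_univ, Fintype.card_fin,
    nsmul_eq_mul]
  rw [← sum_mul, ← mul_sum, hsum]
  field_simp
  ring

theorem exists_equipartition_map (n : ℕ) {l : ℕ} (hl : 1 ≤ l) :
    ∃ p : Fin n → Fin l, ∀ i, |(#{v | p v = i} : ℝ) - n / l| ≤ 1 := by
  refine ⟨fun v => ⟨v % l, Nat.mod_lt _ hl⟩, fun i => ?_⟩
  have hcard : #{v : Fin n | (⟨v % l, Nat.mod_lt _ hl⟩ : Fin l) = i} =
      n.count (· ≡ i [MOD l]) := by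
    rw [Nat.count_eq_card_filter_range, ← card_map Fin.valEmbedding]
    congr 1
    ext x
    simp only [Finset.mem_map, mem_filter, mem_univ, true_and, Fin.valEmbedding_apply, mem_range,
      Fin.ext_iff, Nat.ModEq, Nat.mod_eq_of_lt i.2]
    constructor
    · rintro ⟨v, hv, rfl⟩
      exact ⟨v.2, hv⟩
    · exact fun h => ⟨⟨x, h.1⟩, h.2, rfl⟩
  rw [hcard, Nat.count_modEq_card _ hl]
  have hl' : (0 : ℝ) < l := by exact_mod_cast hl
  have hn : (n : ℝ) / l = (n / l : ℕ) + ((n % l : ℕ) : ℝ) / l := by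
    have h : (n : ℝ) = (n / l : ℕ) * l + (n % l : ℕ) := by
      exact_mod_cast (Nat.div_add_mod' n l).symm
    conv_lhs => rw [h, add_div, mul_div_cancel_right₀ _ hl'.ne']
  have h0 : 0 ≤ ((n % l : ℕ) : ℝ) / l := by positivity
  have h1 : ((n % l : ℕ) : ℝ) / l ≤ 1 := by
    rw [div_le_one hl']
    exact_mod_cast (Nat.mod_lt n hl).le
  rw [hn, abs_le]
  push_cast
  split_ifs <;> constructor <;> linarith

/-- The loss from imbalance pays for the choice of partition (`l * n`), the inside (n^(2-δ)) and the
rounding of the equipartition (`l / 2`), with `n` to spare. -/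
theorem eventually_exponent_le (l : ℕ) {δ : ℝ} (h0 : 0 < δ) (h1 : δ < 1) :
    ∀ᶠ n : ℕ in atTop, (l : ℝ) * n + (n : ℝ) ^ (2 - δ) + l / 2 - (n : ℝ) ^ (2 - δ / 2) / 2 ≤ -n := by
  have h : ∀ᶠ n : ℕ in atTop, (4 * l + 4 : ℝ) ≤ (n : ℝ) ^ (δ / 2) :=
    ((tendsto_rpow_atTop (half_pos h0)).comp tendsto_natCast_atTop_atTop).eventually_ge_atTop _
  filter_upwards [h, eventually_ge_atTop 1] with n hn hn1
  have hn1' : (1 : ℝ) ≤ n := by exact_mod_cast hn1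
  have hsplit : (n : ℝ) ^ (2 - δ / 2) = (n : ℝ) ^ (2 - δ) * (n : ℝ) ^ (δ / 2) := by
    rw [← Real.rpow_add (by linarith)]
    congr 1
    ring
  have hny : (n : ℝ) ≤ (n : ℝ) ^ (2 - δ) := by
    calc (n : ℝ) = (n : ℝ) ^ (1 : ℝ) := (Real.rpow_one _).symm
      _ ≤ _ := Real.rpow_le_rpow_of_exponent_le hn1' (by linarith)
  rw [hsplit]
  set y := (n : ℝ) ^ (2 - δ)
  have hl : (0 : ℝ) ≤ l := by positivity
  nlinarith [mul_le_mul_of_nonneg_left hn (by linarith : 0 ≤ y), mul_le_mul_of_nonneg_left hny hl]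

end GraphFamily

/-! ### Summing over all partitions. -/

namespace GraphFamily

open SimpleGraph Finset Filter

theorem isBalanced_iff {n l : ℕ} {ε : ℝ} {p : Fin n → Fin l} :
    IsBalanced ε (fun i => {v | p v = i}) ↔
      ∀ i, |(#{v | p v = i} : ℝ) - n / l| ≤ (n : ℝ) ^ (1 - ε) := by
  simp [IsBalanced, Set.ncard_eq_toFinset_card']

open scoped Classical in
/-- The graphs on `n` vertices that admit a `𝒯`-partition. -/
noncomputable def partitionableGraphs {l : ℕ} (𝒯 : Fin l → GraphFamily) (n : ℕ) :
    Finset (SimpleGraph (Fin n)) :=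
  univ.biUnion fun p => partitionedBy 𝒯 p

open scoped Classical in
theorem exists_card_unbalanced_le {l : ℕ} (hl : 1 ≤ l) {𝒯 : Fin l → GraphFamily} {k : ℕ}
    (hk : 2 ≤ k) (h𝒯 : IsUnsplit k 𝒯)
    (hbase : ∀ i, Subfamily edgeless (𝒯 i) ∨ Subfamily complete (𝒯 i)) :
    ∃ ε : ℝ, 0 < ε ∧ ∀ᶠ n : ℕ in atTop,
      (∑ p : Fin n → Fin l with ¬ IsBalanced ε (fun i => {v | p v = i}),
        #(partitionedBy 𝒯 p) : ℝ) ≤ (1 / 2) ^ n * #(partitionableGraphs 𝒯 n) := by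
  obtain ⟨δ, h0, h1, hδ⟩ := h𝒯.exists_card_partitionedBy_le hk
  -- The squared deviation is then n^(2-δ/2), of larger order than n^(2-δ).
  refine ⟨δ / 4, by positivity, ?_⟩
  filter_upwards [hδ, eventually_exponent_le l h0 h1] with n hn hexp
  obtain ⟨p₀, hp₀⟩ := exists_equipartition_map n hl
  have hN : (2 : ℝ) ^ (#(crossing p₀).edgeFinset : ℝ) ≤ #(partitionableGraphs 𝒯 n) := by
    rw [Real.rpow_natCast]
    exact_mod_cast (two_pow_le_card_partitionedBy hbase p₀).trans
      (card_le_card (subset_biUnion_of_mem (fun p => partitionedBy 𝒯 p) (mem_univ p₀)))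
  have hcross₀ : ∑ i, ((#{v | p₀ v = i} : ℝ) - n / l) ^ 2 ≤ l := by
    refine (sum_le_sum fun i _ => (sq_le_one_iff_abs_le_one _).2 (hp₀ i)).trans ?_
    simp
  have hsq : ((n : ℝ) ^ (1 - δ / 4)) ^ 2 = (n : ℝ) ^ (2 - δ / 2) := by
    rw [← Real.rpow_mul_natCast (by positivity)]
    congr 1
    push_cast
    ring
  have hterm : ∀ p : Fin n → Fin l, ¬ IsBalanced (δ / 4) (fun i => {v | p v = i}) →
      (#(partitionedBy 𝒯 p) : ℝ) ≤
        2 ^ (-(n : ℝ) - l * n) * #(partitionableGraphs 𝒯 n) := by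
    intro p hp
    rw [isBalanced_iff] at hp
    push Not at hp
    obtain ⟨i, hi⟩ := hp
    have hcross : (n : ℝ) ^ (2 - δ / 2) ≤ ∑ i, ((#{v | p v = i} : ℝ) - n / l) ^ 2 := by
      refine le_trans ?_ (single_le_sum (fun i _ => sq_nonneg ((#{v | p v = i} : ℝ) - n / l))
        (mem_univ i))
      rw [← hsq, ← sq_abs ((#{v | p v = i} : ℝ) - n / l)]
      gcongr
    have e₀ := two_mul_card_crossing_eq hl p₀
    have e := two_mul_card_crossing_eq hl p
    calc (#(partitionedBy 𝒯 p) : ℝ)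
        ≤ 2 ^ (#(crossing p).edgeFinset : ℝ) * 2 ^ ((n : ℝ) ^ (2 - δ)) := hn p
      _ = 2 ^ ((#(crossing p).edgeFinset : ℝ) + (n : ℝ) ^ (2 - δ)) :=
        (Real.rpow_add (by norm_num) _ _).symm
      _ ≤ 2 ^ ((-(n : ℝ) - l * n) + #(crossing p₀).edgeFinset) :=
        Real.rpow_le_rpow_of_exponent_le (by norm_num) (by linarith)
      _ = 2 ^ (-(n : ℝ) - l * n) * 2 ^ (#(crossing p₀).edgeFinset : ℝ) :=
        Real.rpow_add (by norm_num) _ _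
      _ ≤ _ := by gcongr
  calc (∑ p : Fin n → Fin l with ¬ IsBalanced (δ / 4) (fun i => {v | p v = i}),
        #(partitionedBy 𝒯 p) : ℝ)
      ≤ ∑ p : Fin n → Fin l with ¬ IsBalanced (δ / 4) (fun i => {v | p v = i}),
        2 ^ (-(n : ℝ) - l * n) * (#(partitionableGraphs 𝒯 n) : ℝ) :=
        sum_le_sum fun p hp => hterm p (mem_filter.1 hp).2
    _ ≤ (2 ^ (l * n) : ℕ) * (2 ^ (-(n : ℝ) - l * n) * (#(partitionableGraphs 𝒯 n) : ℝ)) := by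
        rw [sum_const, nsmul_eq_mul]
        gcongr
        refine (card_filter_le _ _).trans ?_
        rw [card_univ, Fintype.card_fun, Fintype.card_fin, Fintype.card_fin, pow_mul]
        exact Nat.pow_le_pow_left Nat.lt_two_pow_self.le _
    _ = (1 / 2) ^ n * #(partitionableGraphs 𝒯 n) := by
        rw [← mul_assoc]
        congr 1
        push_cast
        rw [← Real.rpow_natCast, ← Real.rpow_add (by norm_num)]
        push_cast
        rw [add_sub_cancel, Real.rpow_neg (by norm_num), Real.rpow_natCast, one_div, inv_pow]

open scoped Classical in
theorem exists_card_ambiguous_le {l : ℕ} (hl : 1 ≤ l) (𝒯 : Fin l → GraphFamily) {k : ℕ}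
    (hk : 2 ≤ k) {ε : ℝ} (hε : 0 < ε) :
    ∃ η : ℕ → ℝ, Tendsto η atTop (nhds 0) ∧ (∀ n, 0 ≤ η n) ∧ ∀ᶠ n : ℕ in atTop,
      ∀ p : Fin n → Fin l, IsBalanced ε (fun i => {v | p v = i}) →
        (#{G ∈ partitionedBy 𝒯 p | IsAmbiguous k G p} : ℝ) ≤ η n * #(partitionedBy 𝒯 p) := by
  obtain ⟨R, hkR, hR⟩ := exists_homogeneous (2 * k)
  -- Balanced parts have at least n/(2l) vertices; with r = n/(4l²R) this leaves room for both size
  -- conditions of `card_isAmbiguous_le`.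
  have hK : 1 ≤ 4 * l ^ 2 * R := Nat.mul_pos (Nat.mul_pos (by norm_num) (pow_pos hl 2)) (by omega)
  have hM : (1 : ℝ) < (2 ^ (2 * k) : ℕ) := by
    exact_mod_cast Nat.one_lt_two_pow (by omega)
  have hc0 : (0 : ℝ) < 1 - 1 / (2 ^ (2 * k) : ℕ) := by
    rw [sub_pos, div_lt_one (by linarith)]
    exact hM
  have hc1 : (1 : ℝ) - 1 / (2 ^ (2 * k) : ℕ) < 1 := by
    rw [sub_lt_self_iff]
    positivity
  obtain ⟨s, hs⟩ := exists_tendsto_ambiguity_bound l hK hc0 hc1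
  refine ⟨_, hs, fun n => by positivity, ?_⟩
  have hl0 : (0 : ℝ) < l := by exact_mod_cast hl
  have hr : ∀ᶠ n : ℕ in atTop, s ≤ n / (4 * l ^ 2 * R) :=
    (Nat.tendsto_div_const_atTop (by omega)).eventually_ge_atTop s
  have hbal : ∀ᶠ n : ℕ in atTop, (2 * l : ℝ) ≤ (n : ℝ) ^ ε :=
    ((tendsto_rpow_atTop hε).comp tendsto_natCast_atTop_atTop).eventually_ge_atTop _
  filter_upwards [hr, hbal, eventually_ge_atTop (max 1 (4 * l ^ 3 * s))] with n hr hbal hn p hp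
  have hn1 : 1 ≤ n := (le_max_left _ _).trans hn
  have hn2 : 4 * l ^ 3 * s ≤ n := (le_max_right _ _).trans hn
  have hn0 : (0 : ℝ) < n := by exact_mod_cast hn1
  have : Nonempty (Fin n) := ⟨⟨0, hn1⟩⟩
  set r := n / (4 * l ^ 2 * R)
  have hrn : 4 * l ^ 2 * (r * R) ≤ n := by
    calc 4 * l ^ 2 * (r * R) = r * (4 * l ^ 2 * R) := by ring
      _ ≤ n := Nat.div_mul_le_self _ _
  have hsize : ∀ i, n ≤ 2 * l * #{v | p v = i} := by
    intro i
    have h := (abs_le.1 (isBalanced_iff.1 hp i)).1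
    have hpow : (n : ℝ) ^ (1 - ε) ≤ n / (2 * l) := by
      rw [Real.rpow_sub hn0, Real.rpow_one]
      gcongr
    have h2 : (n : ℝ) / l = n / (2 * l) + n / (2 * l) := by
      field_simp
      ring
    have h3 : (n : ℝ) / (2 * l) ≤ #{v | p v = i} := by linarith
    rw [div_le_iff₀' (by positivity)] at h3
    exact_mod_cast h3
  have hRpos : 1 ≤ R := by omega
  refine card_filter_partitionedBy_le 𝒯 p _ fun H hH => ?_
  have := card_isAmbiguous_le (p := p) (k := k) (s := s) (r := r) hkR hR hH ?_ ?_ ?_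
  · simpa only [Fintype.card_fin] using this
  · exact hr.trans (Nat.le_mul_of_pos_right _ hRpos)
  · intro i
    rw [Fintype.card_fin]
    have h := hrn.trans (hsize i)
    have h' : 2 * l * (l * (r * R)) ≤ 2 * l * #{v | p v = i} := by
      refine le_trans ?_ h
      calc 2 * l * (l * (r * R)) = 2 * l ^ 2 * (r * R) := by ring
        _ ≤ 4 * l ^ 2 * (r * R) := by gcongr; norm_num
    convert Nat.le_of_mul_le_mul_left h' (Nat.mul_pos two_pos hl)
  · intro i
    rw [Fintype.card_fin]
    have h' : 2 * l * (r * R + l * s) ≤ 2 * l * #{v | p v = i} := by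
      refine le_trans ?_ (hsize i)
      have h1 : 2 * (2 * l * (r * R)) ≤ n := by
        refine le_trans ?_ hrn
        calc 2 * (2 * l * (r * R)) = 4 * l * (r * R) := by ring
          _ ≤ 4 * l ^ 2 * (r * R) := by
            gcongr
            exact Nat.le_self_pow two_ne_zero l
      have h2 : 2 * (2 * l * (l * s)) ≤ n := by
        refine le_trans ?_ hn2
        calc 2 * (2 * l * (l * s)) = 4 * l ^ 2 * s := by ring
          _ ≤ 4 * l ^ 3 * s := by
            gcongr
            norm_num
      rw [mul_add]
      omega
    convert Nat.le_of_mul_le_mul_left h' (Nat.mul_pos two_pos hl)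

-- Double counting: if `G` is unambiguous for `p₀`, each of its `𝒯`-partitions is `τ ∘ p₀` for a
-- permutation `τ`, so `G` is counted at most l! times.
open scoped Classical in
theorem sum_card_not_isAmbiguous_le {l : ℕ} {𝒯 : Fin l → GraphFamily} {k n : ℕ}
    (h𝒯 : IsUnsplit k 𝒯) (S : Finset (Fin n → Fin l)) :
    ∑ p ∈ S, #{G ∈ partitionedBy 𝒯 p | ¬ IsAmbiguous k G p} ≤
      l.factorial * #(partitionableGraphs 𝒯 n) := by
  have hswap := sum_card_bipartiteAbove_eq_sum_card_bipartiteBelow (s := S)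
    (t := partitionableGraphs 𝒯 n)
    (fun p G => G ∈ partitionedBy 𝒯 p ∧ ¬ IsAmbiguous k G p)
  have heq : ∀ p ∈ S, #{G ∈ partitionedBy 𝒯 p | ¬ IsAmbiguous k G p} =
      #((partitionableGraphs 𝒯 n).bipartiteAbove
        (fun p G => G ∈ partitionedBy 𝒯 p ∧ ¬ IsAmbiguous k G p) p) := by
    intro p _
    congr 1
    ext G
    simp only [bipartiteAbove, mem_filter, partitionableGraphs, mem_biUnion, mem_univ, true_and]
    exact ⟨fun h => ⟨⟨p, h.1⟩, h⟩, fun h => h.2⟩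
  rw [sum_congr rfl heq, hswap, mul_comm]
  refine sum_le_card_nsmul _ _ _ fun G _ => ?_
  rcases (S.bipartiteBelow (fun p G => G ∈ partitionedBy 𝒯 p ∧ ¬ IsAmbiguous k G p) G
    ).eq_empty_or_nonempty with h | ⟨p₀, hp₀⟩
  · rw [h]
    simp
  · have hsub : S.bipartiteBelow (fun p G => G ∈ partitionedBy 𝒯 p ∧ ¬ IsAmbiguous k G p) G ⊆
        (univ : Finset (Equiv.Perm (Fin l))).image fun τ : Equiv.Perm (Fin l) => ⇑τ ∘ p₀ := by
      intro p hp
      simp only [bipartiteBelow, mem_filter] at hp hp₀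
      by_contra hne
      refine hp₀.2.2 ⟨p, h𝒯 G p (mem_partitionedBy.1 hp.2.1), ?_⟩
      rintro ⟨τ, hτ⟩
      exact hne (mem_image.2 ⟨τ, mem_univ _, (funext hτ).symm⟩)
    refine (card_le_card hsub).trans (card_image_le.trans ?_)
    rw [card_univ, Fintype.card_perm, Fintype.card_fin]

open scoped Classical in
/-- A partitionable graph that is not uniquely balanced has an unbalanced partition or a balanced
ambiguous one. -/
theorem exists_unbalanced_or_isAmbiguous {l n k : ℕ} {𝒯 : Fin l → GraphFamily}
    (h𝒯 : IsUnsplit k 𝒯) {ε : ℝ} {G : SimpleGraph (Fin n)} (hG : (partitionable 𝒯).Mem G)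
    (hG' : ¬ (uniquelyBalanced 𝒯 ε).Mem G) :
    ∃ p : Fin n → Fin l, G ∈ partitionedBy 𝒯 p ∧
      (IsBalanced ε (fun i => {v | p v = i}) → IsAmbiguous k G p) := by
  obtain ⟨X, hX⟩ := hG
  obtain ⟨p, hp, -⟩ := hX.exists_map
  refine ⟨p, mem_partitionedBy.2 hp, fun hbal => ?_⟩
  by_contra hamb
  refine hG' ⟨_, hp.isPartition, hbal, fun Y hY => ?_⟩
  obtain ⟨q, hq, rfl⟩ := hY.exists_map
  by_contra hne
  refine hamb ⟨q, h𝒯 G q hq, ?_⟩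
  rintro ⟨τ, hτ⟩
  -- The inverse appears because the fibre of `q = τ ∘ p` over `i` is that of `p` over `τ⁻¹ i`.
  refine hne ⟨τ.symm, ?_⟩
  funext i
  ext v
  simp [hτ, Equiv.eq_symm_apply]

/-- Closing bookkeeping: `q` counts balanced pairs, `a` the ambiguous and `g` the unambiguous ones,
`b` the bad graphs. From q = a + g ≤ q/2 + fN follows q ≤ 2fN, hence a ≤ 2fηN. -/
theorem mul_le_sub_of_le_add {N f η u a g q b h : ℝ} (hu : u ≤ h * N) (hb : b ≤ u + a)
    (ha : a ≤ η * q) (hq : q = a + g) (hg : g ≤ f * N) (hη0 : 0 ≤ η) (hη : η ≤ 1 / 2)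
    (hq0 : 0 ≤ q) : (1 - (h + 2 * f * η)) * N ≤ N - b := by
  have h1 := mul_le_mul_of_nonneg_right hη hq0
  have h2 : q ≤ 2 * (f * N) := by linarith
  have h3 := mul_le_mul_of_nonneg_left h2 hη0
  linarith

end GraphFamily

open Filter Finset GraphFamily in
theorem corollary2p11 (l : ℕ) (hl : 1 ≤ l) (𝒯 : Fin l → GraphFamily)
    (hereditary : ∀ i, (𝒯 i).IsHereditary)
    (meager : ∀ i, (𝒯 i).IsMeager)
    (extendable : ∀ i, (𝒯 i).IsExtendable) :
    ∃ ε : ℝ, 0 < ε ∧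
      GraphFamily.AlmostAll (GraphFamily.partitionable 𝒯)
        (GraphFamily.uniquelyBalanced 𝒯 ε) := by
  classical
  obtain ⟨k, hk, h𝒯⟩ := exists_isUnsplit hereditary meager fun i => (extendable i).1
  have hbase := fun i => edgeless_or_complete_subfamily (extendable i).1
  obtain ⟨ε, hε, hunbal⟩ := exists_card_unbalanced_le hl hk h𝒯 hbase
  obtain ⟨η, hη, hη0, hamb⟩ := exists_card_ambiguous_le hl 𝒯 hk hε
  refine ⟨ε, hε, ?_⟩
  have hlim : Tendsto (fun n : ℕ => 1 - ((1 / 2) ^ n + 2 * l.factorial * η n)) atTop (nhds 1) := by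
    have h1 : Tendsto (fun n : ℕ => ((1 : ℝ) / 2) ^ n) atTop (nhds 0) :=
      tendsto_pow_atTop_nhds_zero_of_lt_one (by norm_num) (by norm_num)
    simpa using (h1.add (hη.const_mul (2 * l.factorial : ℝ))).const_sub 1
  refine tendsto_of_tendsto_of_tendsto_of_le_of_le' hlim tendsto_const_nhds ?_ ?_
  · filter_upwards [hunbal, hamb, hη.eventually_le_const (show (0 : ℝ) < 1 / 2 by norm_num)]
      with n hunbal hamb hη2
    set N := partitionableGraphs 𝒯 n with hN
    set F := (partitionable 𝒯).onFin n with hF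
    set P := (uniquelyBalanced 𝒯 ε).onFin n with hP
    have hmem : ∀ G, G ∈ N ↔ G ∈ F := by
      intro G
      simp only [hN, hF, partitionableGraphs, mem_biUnion, mem_univ, true_and, mem_partitionedBy]
      exact ⟨fun ⟨p, hp⟩ => ⟨_, hp.isPartition⟩,
        fun ⟨X, hX⟩ => let ⟨p, hp, _⟩ := hX.exists_map; ⟨p, hp⟩⟩
    have hFN : F = (N : Set (SimpleGraph (Fin n))) := Set.ext fun G => (hmem G).symm
    have hcardF : F.ncard = #N := by rw [hFN, Set.ncard_coe_finset]
    have hNpos : (0 : ℝ) < #N := by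
      obtain ⟨p, -⟩ := exists_equipartition_map n hl
      have h1 := two_pow_le_card_partitionedBy hbase p
      have h2 : #(partitionedBy 𝒯 p) ≤ #N :=
        card_le_card (subset_biUnion_of_mem (fun p => partitionedBy 𝒯 p) (mem_univ p))
      exact_mod_cast (Nat.two_pow_pos _).trans_le (h1.trans h2)
    set bal : Finset (Fin n → Fin l) := {p | IsBalanced ε (fun i => {v | p v = i})}
    set unbal : Finset (Fin n → Fin l) := {p | ¬ IsBalanced ε (fun i => {v | p v = i})}
    have hsub : F \ P ⊆ ((unbal.biUnion fun p => partitionedBy 𝒯 p) ∪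
        bal.biUnion fun p => {G ∈ partitionedBy 𝒯 p | SimpleGraph.IsAmbiguous k G p} :
          Finset (SimpleGraph (Fin n))) := by
      rintro G ⟨hGF, hGP⟩
      obtain ⟨p, hp, hb⟩ := exists_unbalanced_or_isAmbiguous h𝒯 hGF hGP
      rw [mem_coe, mem_union, mem_biUnion, mem_biUnion]
      by_cases h : IsBalanced ε (fun i => {v | p v = i})
      · exact Or.inr ⟨p, by simpa [bal] using h, mem_filter.2 ⟨hp, hb h⟩⟩
      · exact Or.inl ⟨p, by simpa [unbal] using h, hp⟩
    have hbad : ((F \ P).ncard : ℝ) ≤ ∑ p ∈ unbal, (#(partitionedBy 𝒯 p) : ℝ) +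
        ∑ p ∈ bal, (#{G ∈ partitionedBy 𝒯 p | SimpleGraph.IsAmbiguous k G p} : ℝ) := by
      have h := Set.ncard_le_ncard hsub (finite_toSet _)
      rw [Set.ncard_coe_finset] at h
      exact_mod_cast h.trans ((card_union_le _ _).trans
        (add_le_add card_biUnion_le card_biUnion_le))
    have hgood : (∑ p ∈ bal, (#{G ∈ partitionedBy 𝒯 p | ¬ SimpleGraph.IsAmbiguous k G p} : ℝ)) ≤
        l.factorial * #N := by
      exact_mod_cast sum_card_not_isAmbiguous_le h𝒯 bal
    have hambsum : ∑ p ∈ bal, (#{G ∈ partitionedBy 𝒯 p | SimpleGraph.IsAmbiguous k G p} : ℝ) ≤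
        η n * ∑ p ∈ bal, (#(partitionedBy 𝒯 p) : ℝ) := by
      rw [mul_sum]
      exact sum_le_sum fun p hp => hamb p (by simpa [bal] using hp)
    have hsplit : ∑ p ∈ bal, (#(partitionedBy 𝒯 p) : ℝ) =
        ∑ p ∈ bal, (#{G ∈ partitionedBy 𝒯 p | SimpleGraph.IsAmbiguous k G p} : ℝ) +
          ∑ p ∈ bal, (#{G ∈ partitionedBy 𝒯 p | ¬ SimpleGraph.IsAmbiguous k G p} : ℝ) := by
      rw [← sum_add_distrib]
      refine sum_congr rfl fun p _ => ?_
      exact_mod_cast (card_filter_add_card_filter_not _).symm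
    have hdiff : (F ∩ P).ncard + (F \ P).ncard = F.ncard :=
      Set.ncard_inter_add_ncard_sdiff_eq_ncard F P
    have hdiff' : ((F ∩ P).ncard : ℝ) = #N - (F \ P).ncard := by
      rw [eq_sub_iff_add_eq, ← hcardF]
      exact_mod_cast hdiff
    rw [hcardF, le_div_iff₀ hNpos, hdiff']
    have hQ0 : 0 ≤ ∑ p ∈ bal, (#(partitionedBy 𝒯 p) : ℝ) := sum_nonneg fun _ _ => Nat.cast_nonneg _
    have hu : ∑ p ∈ unbal, (#(partitionedBy 𝒯 p) : ℝ) ≤ (1 / 2) ^ n * #N := hunbal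
    clear hunbal hamb
    clear_value unbal bal N F P
    generalize ∑ p ∈ bal, (#(partitionedBy 𝒯 p) : ℝ) = q at hambsum hsplit hQ0
    generalize ∑ p ∈ unbal, (#(partitionedBy 𝒯 p) : ℝ) = u at hbad hu
    exact mul_le_sub_of_le_add hu hbad hambsum hsplit hgood (hη0 n) hη2 hQ0
  · refine Eventually.of_forall fun n => div_le_one_of_le₀ ?_ (by positivity)
    exact_mod_cast Set.ncard_le_ncard Set.inter_subset_left (Set.toFinite _)
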